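/- Let $d\in\{2,3\}$. For $\varepsilon\in(0,1)$ the phase field crystal (PFC) energy on a bounded open set $\Omega\subset\mathbb R^d$ is $$\mathcal E_\varepsilon(\phi)=\int_\Omega\Big(\tfrac14\phi^4-\tfrac{\varepsilon}{2}\phi^2+\tfrac12\,\phi\,(I+\Delta)^2\phi\Big)\,dx ,$$ where, on functions satisfying one of the boundary conditions below, $\int_\Omega\phi(I+\Delta)^2\phi\,dx$ means $\int_\Omega\big((I+\Delta)\phi\big)^2dx$ (the two are equal when $\Delta^2\phi$ exists and both $\phi$ and $\Delta\phi$ satisfy the boundary condition). One of two settings is considered. (N) Homogeneous Neumann boundary condition: $\Omega\subset\mathbb R^d$ is a bounded domain (open and connected) satisfying the cone condition (every point of $\Omega$ is the vertex of a finite cone contained in $\Omega$ and congruent to a fixed one; for instance, $\Omega$ is a bounded Lipschitz domain). Admissible functions are the $\phi\in H^1(\Omega)$ with $\Delta\phi\in L^2(\Omega)$ and $\partial\phi/\partial n=0$ on $\partial\Omega$, in the variational sense that $\int_\Omega\nabla\phi\cdot\nabla w\,dx=-\int_\Omega\Delta\phi\,w\,dx$ for all $w\in H^1(\Omega)$. (P)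 Periodic boundary condition: $\Omega=\prod_{i=1}^d(a_i,b_i)$ with $a_i<b_i$. Admissible functions are the $\phi\in H^1_{\rm per}(\Omega)$ with $\Delta\phi\in L^2(\Omega)$, in the variational sense that $\int_\Omega\nabla\phi\cdot\nabla w\,dx=-\int_\Omega\Delta\phi\,w\,dx$ for all $w\in H^1_{\rm per}(\Omega)$. Lemma 3.1. In either setting, for every admissible $v$ there is a constant $M(v,\Omega)$, depending only on $v$ and $\Omega$ (in particular, not on $\varepsilon$), such that for every $\varepsilon\in(0,1)$ and every admissible $u$ with $$\int_\Omega u\,dx=\int_\Omega v\,dx\qquad\text{and}\qquad\mathcal E_\varepsilon(u)\le\mathcal E_\varepsilon(v)$$ one has $\|u\|_{L^\infty(\Omega)}\le M(v,\Omega)$. -/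

import Mathlib

open MeasureTheory
open scoped ENNReal ContDiff RealInnerProductSpace Gradient

/-- The open box with corners `a` and `b`, the cell of a periodic problem. -/
def openBox {d : ℕ} (a b : Fin d → ℝ) : Set (EuclideanSpace ℝ (Fin d)) :=
  {x | ∀ i, a i < x i ∧ x i < b i}

/-- The finite open cone of height `h` with vertex `x` and axis direction `e` (a unit vector);
`c` is the cosine of the half-angle. -/
def finiteCone {d : ℕ} (x e : EuclideanSpace ℝ (Fin d)) (h c : ℝ) :
    Set (EuclideanSpace ℝ (Fin d)) :=
  {y | ‖y - x‖ < h ∧ c * ‖y - x‖ < ⟪y - x, e⟫}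

/-- The (interior) cone condition: every point of `Ω` is the vertex of a finite cone contained in
`Ω` and congruent to one fixed finite cone. Every bounded Lipschitz domain satisfies it. -/
def ConeCondition {d : ℕ} (Ω : Set (EuclideanSpace ℝ (Fin d))) : Prop :=
  ∃ h c : ℝ, 0 < h ∧ 0 < c ∧ c < 1 ∧
    ∀ x ∈ Ω, ∃ e : EuclideanSpace ℝ (Fin d), ‖e‖ = 1 ∧ finiteCone x e h c ⊆ Ω

/-- The test functions of the Neumann problem: `C_c^∞(Ω)`. Used as the class `T` below they make
`MemH1` the ordinary Sobolev space `H¹(Ω)`. -/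
def compactTests {d : ℕ} (Ω : Set (EuclideanSpace ℝ (Fin d))) :
    Set (EuclideanSpace ℝ (Fin d) → ℝ) :=
  {φ | ContDiff ℝ ∞ φ ∧ HasCompactSupport φ ∧ tsupport φ ⊆ Ω}

/-- The test functions of the periodic problem on `openBox a b`: smooth functions on `ℝᵈ` with
period `b i - a i` in the `i`-th coordinate. Used as the class `T` below they make `MemH1` the
periodic Sobolev space `H¹_per`. -/
def periodicTests {d : ℕ} (a b : Fin d → ℝ) : Set (EuclideanSpace ℝ (Fin d) → ℝ) :=
  {φ | ContDiff ℝ ∞ φ ∧ ∀ x i, φ (x + EuclideanSpace.single i (b i - a i)) = φ x}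

/-- `u ∈ L²(Ω)` has the weak gradient `G ∈ L²(Ω)`, in the sense of integration by parts against
the test functions in `T`. -/
structure HasWeakGradient {d : ℕ} (T : Set (EuclideanSpace ℝ (Fin d) → ℝ))
    (Ω : Set (EuclideanSpace ℝ (Fin d))) (u : EuclideanSpace ℝ (Fin d) → ℝ)
    (G : EuclideanSpace ℝ (Fin d) → EuclideanSpace ℝ (Fin d)) : Prop where
  memLp : MemLp u 2 (volume.restrict Ω)
  memLp_grad : MemLp G 2 (volume.restrict Ω)
  integral_eq : ∀ φ ∈ T, ∫ x in Ω, u x • ∇ φ x = -∫ x in Ω, φ x • G x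

/-- `u` lies in the first-order Sobolev space given by the test class `T`: this is `H¹(Ω)` for
`T = compactTests Ω` and `H¹_per` for `T = periodicTests a b`, `Ω = openBox a b`. -/
def MemH1 {d : ℕ} (T : Set (EuclideanSpace ℝ (Fin d) → ℝ))
    (Ω : Set (EuclideanSpace ℝ (Fin d))) (u : EuclideanSpace ℝ (Fin d) → ℝ) : Prop :=
  ∃ G, HasWeakGradient T Ω u G

/-- `u ∈ H¹` has the Laplacian `g ∈ L²(Ω)` and satisfies the boundary condition, in the usual
variational sense: `∫ ∇u · ∇w = -∫ g w` for *all* `w ∈ H¹`.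
For `T = compactTests Ω` the space of all `w` is `H¹(Ω)`, and the identity says that `Δu = g` in
`Ω` and `∂u/∂n = 0` on the boundary; for `T = periodicTests a b` it is `H¹_per`, and the identity
says that `Δu = g` and that `u` and its normal derivatives match across opposite faces. -/
def HasLaplacian {d : ℕ} (T : Set (EuclideanSpace ℝ (Fin d) → ℝ))
    (Ω : Set (EuclideanSpace ℝ (Fin d))) (u g : EuclideanSpace ℝ (Fin d) → ℝ) : Prop :=
  MemLp g 2 (volume.restrict Ω) ∧
    ∃ G, HasWeakGradient T Ω u G ∧
      ∀ w W, HasWeakGradient T Ω w W → ∫ x in Ω, ⟪G x, W x⟫ = -∫ x in Ω, g x * w x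

/-- The functions on `Ω` with `u ∈ H¹`, `Δu ∈ L²` and the boundary condition given by `T`. -/
def Admissible {d : ℕ} (T : Set (EuclideanSpace ℝ (Fin d) → ℝ))
    (Ω : Set (EuclideanSpace ℝ (Fin d))) (u : EuclideanSpace ℝ (Fin d) → ℝ) : Prop :=
  ∃ g, HasLaplacian T Ω u g

open Classical in
/-- The Laplacian of an admissible function (determined almost everywhere on `Ω`). -/
noncomputable def lapl {d : ℕ} (T : Set (EuclideanSpace ℝ (Fin d) → ℝ))
    (Ω : Set (EuclideanSpace ℝ (Fin d))) (u : EuclideanSpace ℝ (Fin d) → ℝ) :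
    EuclideanSpace ℝ (Fin d) → ℝ :=
  if h : Admissible T Ω u then h.choose else 0

theorem hasLaplacian_lapl {d : ℕ} {T : Set (EuclideanSpace ℝ (Fin d) → ℝ)}
    {Ω : Set (EuclideanSpace ℝ (Fin d))} {u : EuclideanSpace ℝ (Fin d) → ℝ}
    (h : Admissible T Ω u) : HasLaplacian T Ω u (lapl T Ω u) := by
  rw [lapl, dif_pos h]
  exact h.choose_spec

/-- The phase field crystal energy
`E(u) = ∫ (u⁴/4 - ε u²/2 + u (I + Δ)² u / 2)`, with the quadratic form of the operator `(I + Δ)²`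
written on its natural domain, `∫ u (I + Δ)² u = ∫ ((I + Δ) u)²`. For functions `u` for which
`Δ²u` is defined and the boundary conditions hold for `u` and for `Δu`, the integral with
`u (I + Δ)² u` is the same: see `pfcEnergy_eq`. -/
noncomputable def pfcEnergy {d : ℕ} (T : Set (EuclideanSpace ℝ (Fin d) → ℝ))
    (Ω : Set (EuclideanSpace ℝ (Fin d))) (ε : ℝ) (u : EuclideanSpace ℝ (Fin d) → ℝ) : ℝ :=
  ∫ x in Ω, (1 / 4 * u x ^ 4 - ε / 2 * u x ^ 2 + 1 / 2 * (u x + lapl T Ω u x) ^ 2)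

theorem pfcEnergy_eq {d : ℕ} (T : Set (EuclideanSpace ℝ (Fin d) → ℝ))
    (Ω : Set (EuclideanSpace ℝ (Fin d))) (ε : ℝ) (u : EuclideanSpace ℝ (Fin d) → ℝ)
    (hu : Admissible T Ω u) (hu' : Admissible T Ω (lapl T Ω u)) :
    pfcEnergy T Ω ε u =
      ∫ x in Ω, (1 / 4 * u x ^ 4 - ε / 2 * u x ^ 2 +
        1 / 2 * (u x * (u x + 2 * lapl T Ω u x + lapl T Ω (lapl T Ω u) x))) := by
  obtain ⟨hg, G, hG, h1⟩ := hasLaplacian_lapl hu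
  obtain ⟨hh, H, hH, h2⟩ := hasLaplacian_lapl hu'
  unfold pfcEnergy
  set g := lapl T Ω u
  set k := lapl T Ω g
  have e1 := h1 g H hH
  have e2 := h2 u G hG
  have i1 : Integrable (fun x => g x * g x) (volume.restrict Ω) := hg.integrable_mul hg
  have i2 : Integrable (fun x => k x * u x) (volume.restrict Ω) := hh.integrable_mul hG.memLp
  have e3 : ∫ x in Ω, k x * u x = ∫ x in Ω, g x * g x := by
    simp_rw [real_inner_comm] at e1 e2
    have : ∫ x in Ω, ⟪G x, H x⟫ = ∫ x in Ω, ⟪H x, G x⟫ := by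
      simp_rw [real_inner_comm]
    linarith
  have i3 : Integrable (fun x => 1 / 2 * (k x * u x - g x * g x)) (volume.restrict Ω) :=
    (i2.sub i1).const_mul _
  have e4 : ∫ x in Ω, 1 / 2 * (k x * u x - g x * g x) = 0 := by
    rw [integral_const_mul, integral_sub i2 i1, e3]; simp
  have e5 : (fun x => 1 / 4 * u x ^ 4 - ε / 2 * u x ^ 2 +
        1 / 2 * (u x * (u x + 2 * g x + k x))) =
      (fun x => 1 / 4 * u x ^ 4 - ε / 2 * u x ^ 2 + 1 / 2 * (u x + g x) ^ 2) +
        fun x => 1 / 2 * (k x * u x - g x * g x) := by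
    funext x; simp only [Pi.add_apply]; ring
  rw [e5]
  by_cases hA : Integrable
    (fun x => 1 / 4 * u x ^ 4 - ε / 2 * u x ^ 2 + 1 / 2 * (u x + g x) ^ 2) (volume.restrict Ω)
  · rw [integral_add' hA i3, e4, add_zero]
  · rw [integral_undef hA, integral_undef]
    intro h
    exact hA (by simpa using h.sub i3)

/-!
The energy controls `u` and `Δu` in `L²`: since `t² / 4 - ε t / 2 ≥ t / 2 - 1` for `t = u²`, the
inequality `E(u) ≤ E(v)` bounds `∫ u²` and `∫ (u + Δu)²` in terms of `v` and `Ω`, uniformly in `ε`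
(`exists_eLpNorm_top_le_of_energy_le`). The theorem therefore follows from Stampacchia's estimate:
in dimensions two and three, a function with `u, Δu ∈ L²` and one of the boundary conditions is
bounded in terms of the `L²` norms of `u` and `Δu` (`exists_ae_abs_le`). The same estimate shows
that admissible functions are bounded, so that the energies are integrals of integrable functions.

Stampacchia's method tests the equation with truncations `w` of `u` at a level `k`, which gives
`∫ w² + |∇w|² ≤ (‖u‖ + ‖Δu‖) ‖w‖` in `L²` norms (`lintegral_trunc_sq_add_le`). It has two
ingredients.

* Truncation is possible in the Sobolev space: the chain rule `∇F(u) = F'(u) ∇u` holds for `C¹`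
  functions `F` with `|F'| ≤ 1` (`AdmitsChainRule`). It is proved on the whole space by mollification
  (`weak_chain_rule`), in an open set by multiplying with a cutoff (`weak_chain_rule_on`), and for
  periodic functions by extending them to the whole space and unfolding integrals over the period
  lattice (`periodic_chain_rule`).
* A Sobolev inequality: `|w(x)| ≤ C ∫ (|w| + |∇w|)(y) |x - y|^(1 - d) dy` almost everywhere
  (`exists_enorm_le_riesz_potential`). For `x ∈ Ω` take a bump `ζ` supported in a ball such that the
  cone over it from `x` lies in `Ω`. The contractions `kₛ(y) = e^(ds) ζ(eˢ (y - x))` satisfy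
  `∂ₛ kₛ = div ((y - x) kₛ)`, so that the rate of change of the mean `∫ w kₛ` is
  `-∫ ∇w · (y - x) kₛ`. Integration over `s` yields the kernel, and the means converge to `w(x)` at
  Lebesgue points.

Over a set of measure `b³` the kernel `|x - y|^(1 - d)` integrates to at most a multiple of `b`, so
by Schur's test `‖w‖ ≤ c b ‖|w| + |∇w|‖` when `w` is supported in a set of measure `b³`. Together
with the energy estimate this bounds the measure of `{u > h}` by a constant times the power `4 / 3`
of that of `{u > k}` over `(h - k)²` (`measure_superlevel_le`), and because the exponent exceeds one
the superlevel sets are null from some level on (`eq_zero_of_superlinear_decay`).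
-/

/-! ### Mollification and the chain rule on the whole space -/

section Mollification

open Filter Topology Metric Convolution ContinuousLinearMap

variable {E : Type*} [NormedAddCommGroup E] [InnerProductSpace ℝ E]

/-- Bump functions centred at the origin whose supports shrink to it. -/
noncomputable def shrinkingBump (E : Type*) [NormedAddCommGroup E] [InnerProductSpace ℝ E]
    (n : ℕ) : ContDiffBump (0 : E) where
  rIn := 1 / (2 * ((n : ℝ) + 1))
  rOut := 1 / ((n : ℝ) + 1)
  rIn_pos := by positivity
  rIn_lt_rOut := by
    apply one_div_lt_one_div_of_lt <;> nlinarith [Nat.cast_nonneg (α := ℝ) n]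

theorem tendsto_shrinkingBump_rOut :
    Tendsto (fun n => (shrinkingBump E n).rOut) atTop (𝓝 0) :=
  tendsto_one_div_add_atTop_nhds_zero_nat

variable [FiniteDimensional ℝ E] [MeasurableSpace E] [BorelSpace E]

/-- The convolution of `f` with the `n`-th normalised bump. -/
noncomputable def mollify (n : ℕ) (f : E → ℝ) : E → ℝ :=
  (shrinkingBump E n).normed volume ⋆[lsmul ℝ ℝ, volume] f

theorem ae_tendsto_mollify {f : E → ℝ} (hf : Integrable f) :
    ∀ᵐ x, Tendsto (fun n => mollify n f x) atTop (𝓝 (f x)) := by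
  refine ContDiffBump.ae_convolution_tendsto_right_of_locallyIntegrable (K := 2)
    tendsto_shrinkingBump_rOut (Eventually.of_forall fun n => ?_) hf.locallyIntegrable
  simp only [shrinkingBump]
  apply le_of_eq
  field_simp

theorem integrable_normed_bump (φ : ContDiffBump (0 : E)) : Integrable (φ.normed volume) :=
  φ.continuous_normed.integrable_of_hasCompactSupport φ.hasCompactSupport_normed

theorem integrable_mollify {f : E → ℝ} (hf : Integrable f) (n : ℕ) :
    Integrable (mollify n f) :=
  (integrable_normed_bump _).integrable_convolution _ hf

theorem lintegral_enorm_normed_bump (φ : ContDiffBump (0 : E)) :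
    ∫⁻ x, ‖φ.normed volume x‖ₑ = 1 := by
  rw [← ofReal_integral_norm_eq_lintegral_enorm (integrable_normed_bump φ)]
  simp_rw [Real.norm_of_nonneg (φ.nonneg_normed _)]
  rw [φ.integral_normed, ENNReal.ofReal_one]

/-- Mollification is a contraction of `L¹`. -/
theorem lintegral_enorm_mollify_le {f : E → ℝ} (hf : Integrable f) (n : ℕ) :
    ∫⁻ x, ‖mollify n f x‖ₑ ≤ ∫⁻ x, ‖f x‖ₑ := by
  set ρ := (shrinkingBump E n).normed volume
  have hρ : Continuous ρ := (shrinkingBump E n).continuous_normed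
  have hm : AEMeasurable (Function.uncurry fun x t : E => ‖ρ t‖ₑ * ‖f (x - t)‖ₑ)
      (volume.prod volume) := by
    have h1 : AEStronglyMeasurable (fun p : E × E => f (p.1 - p.2)) (volume.prod volume) :=
      hf.aestronglyMeasurable.comp_quasiMeasurePreserving
        (quasiMeasurePreserving_sub_of_right_invariant volume volume)
    exact ((hρ.comp continuous_snd).enorm.measurable.aemeasurable).mul h1.enorm
  calc ∫⁻ x, ‖mollify n f x‖ₑ
      ≤ ∫⁻ x, ∫⁻ t, ‖ρ t‖ₑ * ‖f (x - t)‖ₑ := by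
        refine lintegral_mono fun x => ?_
        refine (enorm_integral_le_lintegral_enorm _).trans_eq ?_
        simp [ρ, enorm_mul]
    _ = ∫⁻ t, ∫⁻ x, ‖ρ t‖ₑ * ‖f (x - t)‖ₑ := lintegral_lintegral_swap hm
    _ = ∫⁻ t, ‖ρ t‖ₑ * ∫⁻ x, ‖f x‖ₑ := by
        refine lintegral_congr fun t => ?_
        rw [lintegral_const_mul' _ _ enorm_ne_top,
          lintegral_sub_right_eq_self (fun x => ‖f x‖ₑ) t]
    _ = ∫⁻ x, ‖f x‖ₑ := by
        rw [lintegral_mul_const _ hρ.enorm.measurable, lintegral_enorm_normed_bump, one_mul]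

theorem mollify_sub {f g : E → ℝ} (hf : Integrable f) (hg : Integrable g) (n : ℕ) :
    mollify n (fun x => f x - g x) =ᵐ[volume] fun x => mollify n f x - mollify n g x := by
  have h1 := (integrable_normed_bump (shrinkingBump E n)).ae_convolution_exists
    (lsmul ℝ ℝ) hf
  have h2 := (integrable_normed_bump (shrinkingBump E n)).ae_convolution_exists
    (lsmul ℝ ℝ) hg
  filter_upwards [h1, h2] with x e1 e2
  have e1' : Integrable fun t => (lsmul ℝ ℝ) ((shrinkingBump E n).normed volume t) (f (x - t)) := e1
  have e2' : Integrable fun t => (lsmul ℝ ℝ) ((shrinkingBump E n).normed volume t) (g (x - t)) := e2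
  simp only [mollify, convolution]
  rw [← integral_sub e1' e2']
  simp [mul_sub]

/-- Mollifications of a continuous function with compact support converge in `L¹`. -/
theorem tendsto_lintegral_mollify_sub_of_continuous {g : E → ℝ} (hg : Continuous g)
    (hc : HasCompactSupport g) :
    Tendsto (fun n => ∫⁻ x, ‖mollify n g x - g x‖ₑ) atTop (𝓝 0) := by
  set K := cthickening 1 (tsupport g)
  have hK : IsCompact K := IsCompact.cthickening hc
  have hKf : volume K ≠ ⊤ := hK.measure_lt_top.ne
  have hzero : ∀ n x, x ∉ K → mollify n g x - g x = 0 := by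
    intro n x hx
    have hr : (shrinkingBump E n).rOut ≤ 1 := by
      simp only [shrinkingBump]
      rw [div_le_one (by positivity)]
      linarith [Nat.cast_nonneg (α := ℝ) n]
    have hb : ∀ y ∈ ball x (shrinkingBump E n).rOut, g y = 0 := by
      intro y hy
      by_contra h
      apply hx
      apply mem_cthickening_of_dist_le x y 1 _ (subset_tsupport g h)
      rw [dist_comm]
      exact (mem_ball.1 hy).le.trans hr
    have hx0 : g x = 0 := hb x (mem_ball_self (shrinkingBump E n).rOut_pos)
    have := (shrinkingBump E n).normed_convolution_eq_right (μ := volume) (g := g) (x₀ := x)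
      (fun y hy => by rw [hb y hy, hx0])
    simp only [mollify, this, sub_self]
  rw [ENNReal.tendsto_nhds_zero]
  intro ε hε
  obtain ⟨η, hη, hηε⟩ : ∃ η : ℝ, 0 < η ∧ ENNReal.ofReal η * volume K ≤ ε := by
    obtain ⟨η, hη, h⟩ := ENNReal.exists_nnreal_pos_mul_lt hKf hε.ne'
    exact ⟨η, by exact_mod_cast hη, by simpa using h.le⟩
  obtain ⟨δ, hδ, huc⟩ := Metric.uniformContinuous_iff.1
    (hc.uniformContinuous_of_continuous hg) η hη
  filter_upwards [(tendsto_shrinkingBump_rOut (E := E)).eventually (gt_mem_nhds hδ)] with n hn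
  calc ∫⁻ x, ‖mollify n g x - g x‖ₑ
      = ∫⁻ x in K, ‖mollify n g x - g x‖ₑ := by
        rw [setLIntegral_eq_of_support_subset]
        intro x hx
        by_contra h
        exact hx (by simp [hzero n x h])
    _ ≤ ∫⁻ x in K, ENNReal.ofReal η := by
        refine lintegral_mono fun x => ?_
        rw [← ofReal_norm]
        apply ENNReal.ofReal_le_ofReal
        rw [← dist_eq_norm]
        refine (shrinkingBump E n).dist_normed_convolution_le hg.aestronglyMeasurable ?_
        intro y hy
        exact (huc (lt_trans (mem_ball.1 hy) hn)).le
    _ = ENNReal.ofReal η * volume K := by simp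
    _ ≤ ε := hηε

/-- Mollifications of an integrable function converge in `L¹`. -/
theorem tendsto_lintegral_mollify_sub {f : E → ℝ} (hf : Integrable f) :
    Tendsto (fun n => ∫⁻ x, ‖mollify n f x - f x‖ₑ) atTop (𝓝 0) := by
  rw [ENNReal.tendsto_nhds_zero]
  intro ε hε
  have hε3 : ε / 3 ≠ 0 := (ENNReal.div_pos hε.ne' (by norm_num)).ne'
  obtain ⟨g, hgc, hfg, hg, hgi⟩ := hf.exists_hasCompactSupport_lintegral_sub_le hε3
  filter_upwards [ENNReal.tendsto_nhds_zero.1 (tendsto_lintegral_mollify_sub_of_continuous hg hgc)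
    (ε / 3) (pos_iff_ne_zero.2 hε3)] with n hn
  have hd : Integrable fun x => f x - g x := hf.sub hgi
  have m1 := (integrable_mollify hd n).aestronglyMeasurable.enorm
  have m2 : AEMeasurable (fun x => ‖mollify n g x - g x‖ₑ) :=
    ((integrable_mollify hgi n).sub hgi).aestronglyMeasurable.enorm
  calc ∫⁻ x, ‖mollify n f x - f x‖ₑ
      ≤ ∫⁻ x, (‖mollify n (fun x => f x - g x) x‖ₑ + (‖mollify n g x - g x‖ₑ + ‖f x - g x‖ₑ)) := by
        refine lintegral_mono_ae ?_
        filter_upwards [mollify_sub hf hgi n] with x hx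
        rw [hx]
        have : mollify n f x - f x = (mollify n f x - mollify n g x) +
          ((mollify n g x - g x) - (f x - g x)) := by ring
        rw [this]
        exact (enorm_add_le _ _).trans (by gcongr; exact enorm_sub_le)
    _ = (∫⁻ x, ‖mollify n (fun x => f x - g x) x‖ₑ) +
          ((∫⁻ x, ‖mollify n g x - g x‖ₑ) + ∫⁻ x, ‖f x - g x‖ₑ) := by
        rw [lintegral_add_left' m1, lintegral_add_left' m2]
    _ ≤ ε / 3 + (ε / 3 + ε / 3) := by
        gcongr
        exact (lintegral_enorm_mollify_le hd n).trans hfg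
    _ = ε := by rw [← add_assoc]; exact ENNReal.add_thirds ε

/-- If `g` is the weak derivative of `u` in the direction `e` on the whole space, then the
mollifications of `g` are the derivatives of those of `u`. -/
theorem fderiv_mollify {u g : E → ℝ} {e : E} (hu : Integrable u)
    (h : ∀ φ : E → ℝ, ContDiff ℝ ∞ φ → HasCompactSupport φ →
      ∫ x, u x * fderiv ℝ φ x e = -∫ x, φ x * g x) (n : ℕ) (x : E) :
    fderiv ℝ (mollify n u) x e = mollify n g x := by
  set ρ := (shrinkingBump E n).normed volume with hρdef
  have hρ : ContDiff ℝ ∞ ρ := (shrinkingBump E n).contDiff_normed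
  have hρc : HasCompactSupport ρ := (shrinkingBump E n).hasCompactSupport_normed
  have h1 := hρc.hasFDerivAt_convolution_left (lsmul ℝ ℝ) (hρ.of_le (by simp))
    hu.locallyIntegrable x (μ := volume)
  have hd : Continuous (fderiv ℝ ρ) := hρ.continuous_fderiv (by simp)
  have hex : ConvolutionExistsAt (fderiv ℝ ρ) u x (precompL E (lsmul ℝ ℝ)) volume :=
    (hρc.fderiv ℝ).convolutionExists_left _ hd hu.locallyIntegrable x
  have hex' : Integrable fun t => (precompL E (lsmul ℝ ℝ)) (fderiv ℝ ρ t) (u (x - t)) := hex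
  have h2 : fderiv ℝ (mollify n u) x e = ∫ t, fderiv ℝ ρ t e * u (x - t) := by
    rw [mollify, h1.fderiv, convolution, ContinuousLinearMap.integral_apply hex']
    simp [precompL_apply]
  rw [h2]
  have hφ : ContDiff ℝ ∞ (fun y => ρ (x - y)) := hρ.comp (contDiff_const.sub contDiff_id)
  have hφc : HasCompactSupport (fun y => ρ (x - y)) :=
    hρc.comp_homeomorph (Homeomorph.subLeft x)
  have h3 := h _ hφ hφc
  have hfd : ∀ y, fderiv ℝ (fun y => ρ (x - y)) y e = - fderiv ℝ ρ (x - y) e := by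
    intro y
    have a1 : HasFDerivAt ρ (fderiv ℝ ρ (x - y)) (x - y) :=
      (hρ.differentiable (by simp) _).hasFDerivAt
    have a2 : HasFDerivAt (fun y : E => x - y) (-ContinuousLinearMap.id ℝ E) y :=
      (hasFDerivAt_id y).const_sub x
    have a3 : HasFDerivAt (fun y => ρ (x - y)) _ y := a1.comp y a2
    rw [a3.fderiv]
    simp
  simp_rw [hfd, mul_neg, integral_neg, neg_inj] at h3
  rw [mollify, convolution_lsmul_swap]
  rw [← integral_sub_left_eq_self _ volume x]
  simp only [sub_sub_cancel, smul_eq_mul]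
  rw [← h3]
  simp_rw [mul_comm]

theorem contDiff_mollify {u : E → ℝ} (hu : Integrable u) (n : ℕ) :
    ContDiff ℝ ∞ (mollify n u) :=
  (shrinkingBump E n).hasCompactSupport_normed.contDiff_convolution_left _
    (shrinkingBump E n).contDiff_normed hu.locallyIntegrable

theorem abs_sub_le_of_abs_deriv_le_one {F F' : ℝ → ℝ} (hF : ∀ t, HasDerivAt F (F' t) t)
    (hb : ∀ t, |F' t| ≤ 1) (s t : ℝ) : |F s - F t| ≤ |s - t| := by
  have := Convex.norm_image_sub_le_of_norm_hasDerivWithin_le (f := F) (f' := F') (C := 1)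
    (s := Set.univ) (x := t) (y := s) (fun x _ => (hF x).hasDerivWithinAt) (fun x _ => hb x)
    convex_univ trivial trivial
  simpa using this

/-- The chain rule for weak directional derivatives of integrable functions on the whole space. -/
theorem weak_chain_rule {u g : E → ℝ} {e : E} (hu : Integrable u) (hg : Integrable g)
    (h : ∀ φ : E → ℝ, ContDiff ℝ ∞ φ → HasCompactSupport φ →
      ∫ x, u x * fderiv ℝ φ x e = -∫ x, φ x * g x)
    {F F' : ℝ → ℝ} (hF : ∀ t, HasDerivAt F (F' t) t) (hF'c : Continuous F')
    (hb : ∀ t, |F' t| ≤ 1) {φ : E → ℝ} (hφ : ContDiff ℝ ∞ φ) (hφc : HasCompactSupport φ) :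
    ∫ x, F (u x) * fderiv ℝ φ x e = -∫ x, φ x * (F' (u x) * g x) := by
  have hFc : Continuous F := continuous_iff_continuousAt.2 fun t => (hF t).continuousAt
  have hdc : Continuous (fun x => fderiv ℝ φ x e) :=
    (hφ.continuous_fderiv (by simp)).clm_apply continuous_const
  have hdcs : HasCompactSupport (fun x => fderiv ℝ φ x e) := hφc.fderiv_apply ℝ e
  obtain ⟨C, hC⟩ := hdcs.exists_bound_of_continuous hdc
  obtain ⟨M, hM⟩ := hφc.exists_bound_of_continuous hφ.continuous
  have hdi : Integrable (fun x => fderiv ℝ φ x e) := hdc.integrable_of_hasCompactSupport hdcs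
  have hL := abs_sub_le_of_abs_deriv_le_one hF hb
  have hint : ∀ w : E → ℝ, Integrable w → Integrable (fun x => F (w x) * fderiv ℝ φ x e) := by
    intro w hw
    refine Integrable.mono' (g := fun x => C * |w x| + |F 0| * ‖fderiv ℝ φ x e‖)
      ((hw.abs.const_mul C).add (hdi.norm.const_mul _))
      ((hFc.comp_aestronglyMeasurable hw.aestronglyMeasurable).mul hdc.aestronglyMeasurable)
      (Eventually.of_forall fun x => ?_)
    have h1 : |F (w x)| ≤ |F 0| + |w x| := by
      have := hL (w x) 0
      have h2 := abs_sub_abs_le_abs_sub (F (w x)) (F 0)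
      rw [sub_zero] at this
      linarith
    rw [norm_mul, Real.norm_eq_abs]
    calc |F (w x)| * ‖fderiv ℝ φ x e‖ ≤ (|F 0| + |w x|) * ‖fderiv ℝ φ x e‖ := by gcongr
      _ ≤ _ := by nlinarith [hC x, abs_nonneg (w x)]
  have hint2 : ∀ w k : E → ℝ, Integrable w → Integrable k →
      Integrable (fun x => φ x * (F' (w x) * k x)) := by
    intro w k hw hk
    refine Integrable.mono' (g := fun x => M * |k x|) (hk.abs.const_mul M)
      (hφ.continuous.aestronglyMeasurable.mul
        ((hF'c.comp_aestronglyMeasurable hw.aestronglyMeasurable).mul hk.aestronglyMeasurable))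
      (Eventually.of_forall fun x => ?_)
    rw [norm_mul, norm_mul, Real.norm_eq_abs (F' _), Real.norm_eq_abs (k x)]
    have := hb (w x)
    have h3 := hM x
    have h4 : |F' (w x)| * |k x| ≤ |k x| := by nlinarith [abs_nonneg (k x)]
    calc ‖φ x‖ * (|F' (w x)| * |k x|) ≤ ‖φ x‖ * |k x| := by gcongr
      _ ≤ M * |k x| := by gcongr
  have hsmooth : ∀ n, ∫ x, F (mollify n u x) * fderiv ℝ φ x e =
      -∫ x, φ x * (F' (mollify n u x) * mollify n g x) := by
    intro n
    have hd : Differentiable ℝ (mollify n u) := (contDiff_mollify hu n).differentiable (by simp)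
    have hd' : ∀ x, HasFDerivAt (fun x => F (mollify n u x))
        (F' (mollify n u x) • fderiv ℝ (mollify n u) x) x := fun x =>
      (hF _).comp_hasFDerivAt x (hd x).hasFDerivAt
    have he : ∀ x, fderiv ℝ (fun x => F (mollify n u x)) x e * φ x =
        φ x * (F' (mollify n u x) * mollify n g x) := by
      intro x
      rw [(hd' x).fderiv, _root_.smul_apply, fderiv_mollify hu h, smul_eq_mul]
      ring
    have hui := integrable_mollify hu n
    rw [integral_mul_fderiv_eq_neg_fderiv_mul_of_integrable]
    · simp_rw [he]
    · simp_rw [he]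
      exact hint2 _ _ hui (integrable_mollify hg n)
    · exact hint _ hui
    · refine Continuous.integrable_of_hasCompactSupport ?_ hφc.mul_left
      exact (hFc.comp hd.continuous).mul hφ.continuous
    · exact fun x _ => (hd' x).differentiableAt
    · exact fun x _ => hφ.differentiable (by simp) x
  have hconv := tendsto_lintegral_mollify_sub hu
  have lim1 : Tendsto (fun n => ∫ x, F (mollify n u x) * fderiv ℝ φ x e) atTop
      (𝓝 (∫ x, F (u x) * fderiv ℝ φ x e)) := by
    refine tendsto_integral_of_L1 _ (hint u hu).aestronglyMeasurable
      (Eventually.of_forall fun n => hint _ (integrable_mollify hu n)) ?_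
    refine tendsto_of_tendsto_of_tendsto_of_le_of_le tendsto_const_nhds
      (h := fun n => ENNReal.ofReal C * ∫⁻ x, ‖mollify n u x - u x‖ₑ) ?_
      (fun _ => zero_le) (fun n => ?_)
    · simpa using ENNReal.Tendsto.const_mul hconv (Or.inr ENNReal.ofReal_ne_top)
    · dsimp only
      rw [← lintegral_const_mul' _ _ ENNReal.ofReal_ne_top]
      refine lintegral_mono fun x => ?_
      rw [← sub_mul, enorm_mul, mul_comm]
      gcongr
      · rw [← ofReal_norm]
        exact ENNReal.ofReal_le_ofReal (hC x)
      · rw [← ofReal_norm, ← ofReal_norm]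
        exact ENNReal.ofReal_le_ofReal (hL _ _)
  have lim2 : Tendsto (fun n => ∫ x, φ x * (F' (mollify n u x) * mollify n g x)) atTop
      (𝓝 (∫ x, φ x * (F' (u x) * g x))) := by
    refine tendsto_integral_of_L1 _ (hint2 u g hu hg).aestronglyMeasurable
      (Eventually.of_forall fun n => hint2 _ _ (integrable_mollify hu n) (integrable_mollify hg n)) ?_
    have hdom : Tendsto (fun n => ∫⁻ x, ‖(F' (mollify n u x) - F' (u x)) * g x‖ₑ) atTop
        (𝓝 (∫⁻ _ : E, 0)) := by
      refine tendsto_lintegral_of_dominated_convergence' (fun x => 2 * ‖g x‖ₑ) (fun n => ?_)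
        (fun n => Eventually.of_forall fun x => ?_) ?_ ?_
      · exact (((hF'c.comp_aestronglyMeasurable (integrable_mollify hu n).aestronglyMeasurable).sub
          (hF'c.comp_aestronglyMeasurable hu.aestronglyMeasurable)).mul
            hg.aestronglyMeasurable).enorm
      · dsimp only
        rw [enorm_mul]
        gcongr
        rw [← ofReal_norm, ← ENNReal.ofReal_ofNat 2]
        apply ENNReal.ofReal_le_ofReal
        refine (norm_sub_le _ _).trans ?_
        have h1 := hb (mollify n u x)
        have h2 := hb (u x)
        rw [← Real.norm_eq_abs] at h1 h2
        linarith
      · rw [lintegral_const_mul' _ _ (by simp)]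
        exact ENNReal.mul_ne_top (by simp) hg.2.ne
      · filter_upwards [ae_tendsto_mollify hu] with x hx
        have h1 : Tendsto (fun n => (F' (mollify n u x) - F' (u x)) * g x) atTop
            (𝓝 ((F' (u x) - F' (u x)) * g x)) :=
          (((hF'c.tendsto _).comp hx).sub tendsto_const_nhds).mul tendsto_const_nhds
        rw [sub_self, zero_mul] at h1
        simpa using h1.enorm
    rw [lintegral_zero] at hdom
    refine tendsto_of_tendsto_of_tendsto_of_le_of_le tendsto_const_nhds
      (h := fun n => ENNReal.ofReal M * ((∫⁻ x, ‖mollify n g x - g x‖ₑ) +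
        ∫⁻ x, ‖(F' (mollify n u x) - F' (u x)) * g x‖ₑ)) ?_
      (fun _ => zero_le) (fun n => ?_)
    · simpa using ENNReal.Tendsto.const_mul ((tendsto_lintegral_mollify_sub hg).add hdom)
        (Or.inr ENNReal.ofReal_ne_top)
    · dsimp only
      rw [← lintegral_add_left', ← lintegral_const_mul' _ _ ENNReal.ofReal_ne_top]
      · refine lintegral_mono fun x => ?_
        rw [← mul_sub, enorm_mul]
        gcongr
        · rw [← ofReal_norm]
          exact ENNReal.ofReal_le_ofReal (hM x)
        · have : F' (mollify n u x) * mollify n g x - F' (u x) * g x =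
            F' (mollify n u x) * (mollify n g x - g x) +
              (F' (mollify n u x) - F' (u x)) * g x := by ring
          rw [this]
          refine (enorm_add_le _ _).trans ?_
          gcongr
          rw [enorm_mul]
          refine mul_le_of_le_one_left' ?_
          rw [← ofReal_norm, ← ENNReal.ofReal_one]
          exact ENNReal.ofReal_le_ofReal (hb _)
      · exact ((integrable_mollify hg n).sub hg).aestronglyMeasurable.enorm
  refine tendsto_nhds_unique lim1 ?_
  simp_rw [hsmooth]
  exact lim2.neg

end Mollification

/-! ### The chain rule in an open set -/

section LocalChainRule

open Filter Topology Metric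

variable {E : Type*} [NormedAddCommGroup E] [InnerProductSpace ℝ E] [FiniteDimensional ℝ E]

/-- A compact subset `K` of an open set `Ω` has a smooth cutoff function that is `1` near `K` and
is supported in a compact subset of `Ω`. -/
theorem exists_smooth_cutoff {Ω K : Set E} (hΩ : IsOpen Ω) (hK : IsCompact K) (hKΩ : K ⊆ Ω) :
    ∃ χ : E → ℝ, ContDiff ℝ ∞ χ ∧ HasCompactSupport χ ∧ tsupport χ ⊆ Ω ∧
      ∀ x ∈ K, χ =ᶠ[𝓝 x] fun _ => 1 := by
  obtain ⟨K', hK', h1, h2⟩ := exists_compact_between hK hΩ hKΩ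
  obtain ⟨f, hf1, hf0, -⟩ := exists_contMDiffMap_one_nhds_of_subset_interior (n := (⊤ : ℕ∞))
    (modelWithCornersSelf ℝ E) hK.isClosed h1
  have hs : tsupport f ⊆ K' := by
    refine closure_minimal (fun x hx => ?_) hK'.isClosed
    by_contra h
    exact hx (hf0 x h)
  refine ⟨f, f.contMDiff.contDiff, hK'.of_isClosed_subset (isClosed_tsupport _) hs,
    hs.trans h2, fun x hx => ?_⟩
  exact (eventually_nhdsSet_iff_forall.1 hf1 x hx)

variable [MeasurableSpace E] [BorelSpace E]

theorem setIntegral_eq_integral_of_eq_zero {f : E → ℝ} {Ω : Set E} (h : ∀ x ∉ Ω, f x = 0) :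
    ∫ x in Ω, f x = ∫ x, f x :=
  setIntegral_eq_integral_of_forall_compl_eq_zero h

theorem integrable_mul_of_integrableOn_tsupport {u χ : E → ℝ}
    (hχ : Continuous χ) (hχc : HasCompactSupport χ) (hu : IntegrableOn u (tsupport χ)) :
    Integrable (fun x => χ x * u x) := by
  obtain ⟨M, hM⟩ := hχc.exists_bound_of_continuous hχ
  have : IntegrableOn (fun x => χ x * u x) (tsupport χ) :=
    Integrable.bdd_mul (c := M) hu hχ.aestronglyMeasurable (Eventually.of_forall hM)
  rw [integrableOn_iff_integrable_of_support_subset] at this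
  · exact this
  · intro x hx
    exact subset_tsupport _ (left_ne_zero_of_mul hx)

/-- The chain rule for weak directional derivatives of functions that are locally integrable in an
open set. -/
theorem weak_chain_rule_on {Ω : Set E} (hΩ : IsOpen Ω) {u g : E → ℝ} {e : E}
    (hu : ∀ K ⊆ Ω, IsCompact K → IntegrableOn u K) (hg : ∀ K ⊆ Ω, IsCompact K → IntegrableOn g K)
    (h : ∀ φ : E → ℝ, ContDiff ℝ ∞ φ → HasCompactSupport φ → tsupport φ ⊆ Ω →
      ∫ x in Ω, u x * fderiv ℝ φ x e = -∫ x in Ω, φ x * g x)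
    {F F' : ℝ → ℝ} (hF : ∀ t, HasDerivAt F (F' t) t) (hF'c : Continuous F')
    (hb : ∀ t, |F' t| ≤ 1) {φ : E → ℝ} (hφ : ContDiff ℝ ∞ φ) (hφc : HasCompactSupport φ)
    (hφΩ : tsupport φ ⊆ Ω) :
    ∫ x in Ω, F (u x) * fderiv ℝ φ x e = -∫ x in Ω, φ x * (F' (u x) * g x) := by
  obtain ⟨χ, hχ, hχc, hχΩ, hχ1⟩ := exists_smooth_cutoff hΩ hφc hφΩ
  have hdχ : Continuous (fun x => fderiv ℝ χ x e) :=
    (hχ.continuous_fderiv (by simp)).clm_apply continuous_const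
  have hdχc : HasCompactSupport (fun x => fderiv ℝ χ x e) := hχc.fderiv_apply ℝ e
  have hdχs : tsupport (fun x => fderiv ℝ χ x e) ⊆ tsupport χ := tsupport_fderiv_apply_subset ℝ e
  have i1 : Integrable (fun x => χ x * u x) :=
    integrable_mul_of_integrableOn_tsupport hχ.continuous hχc (hu _ hχΩ hχc)
  have i2 : Integrable (fun x => χ x * g x) :=
    integrable_mul_of_integrableOn_tsupport hχ.continuous hχc (hg _ hχΩ hχc)
  have i3 : Integrable (fun x => fderiv ℝ χ x e * u x) :=
    integrable_mul_of_integrableOn_tsupport hdχ hdχc ((hu _ hχΩ hχc).mono_set hdχs)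
  have hχ0 : ∀ x ∉ Ω, χ x = 0 := fun x hx => image_eq_zero_of_notMem_tsupport fun h => hx (hχΩ h)
  have hdχ0 : ∀ x ∉ Ω, fderiv ℝ χ x e = 0 := fun x hx =>
    image_eq_zero_of_notMem_tsupport (f := fun x => fderiv ℝ χ x e) fun h => hx (hχΩ (hdχs h))
  have key := weak_chain_rule (u := fun x => χ x * u x)
    (g := fun x => χ x * g x + fderiv ℝ χ x e * u x) (e := e) i1 (i2.add i3) ?_ hF hF'c hb hφ hφc
  · rw [setIntegral_eq_integral_of_eq_zero, setIntegral_eq_integral_of_eq_zero]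
    · convert key using 2
      · ext x
        by_cases hx : x ∈ tsupport φ
        · rw [(hχ1 x hx).self_of_nhds, one_mul]
        · have : fderiv ℝ φ x e = 0 := image_eq_zero_of_notMem_tsupport
            (f := fun x => fderiv ℝ φ x e) fun h => hx (tsupport_fderiv_apply_subset ℝ e h)
          simp [this]
      · congr 1
        ext x
        by_cases hx : x ∈ tsupport φ
        · rw [(hχ1 x hx).self_of_nhds, (hχ1 x hx).fderiv_eq]
          simp
        · simp [image_eq_zero_of_notMem_tsupport hx]
    · intro x hx
      simp [image_eq_zero_of_notMem_tsupport fun h => hx (hφΩ h)]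
    · intro x hx
      have : fderiv ℝ φ x e = 0 := image_eq_zero_of_notMem_tsupport
        (f := fun x => fderiv ℝ φ x e) fun h => hx (hφΩ (tsupport_fderiv_apply_subset ℝ e h))
      simp [this]
  · intro ψ hψ hψc
    obtain ⟨C, hC⟩ := hψc.exists_bound_of_continuous hψ.continuous
    have hdψ : Continuous (fun x => fderiv ℝ ψ x e) :=
      (hψ.continuous_fderiv (by simp)).clm_apply continuous_const
    obtain ⟨C', hC'⟩ := (hψc.fderiv_apply ℝ e).exists_bound_of_continuous hdψ
    have hp := h (fun x => χ x * ψ x) (hχ.mul hψ) hχc.mul_right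
      ((tsupport_mul_subset_left).trans hχΩ)
    have hd : ∀ x, fderiv ℝ (fun x => χ x * ψ x) x e =
        χ x * fderiv ℝ ψ x e + ψ x * fderiv ℝ χ x e := by
      intro x
      rw [fderiv_fun_mul (hχ.differentiable (by simp) x) (hψ.differentiable (by simp) x)]
      simp
    rw [setIntegral_eq_integral_of_eq_zero, setIntegral_eq_integral_of_eq_zero] at hp
    · have j1 : Integrable (fun x => fderiv ℝ ψ x e * (χ x * u x)) :=
        i1.bdd_mul hdψ.aestronglyMeasurable (Eventually.of_forall hC')
      have j2 : Integrable (fun x => ψ x * (fderiv ℝ χ x e * u x)) :=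
        i3.bdd_mul hψ.continuous.aestronglyMeasurable (Eventually.of_forall hC)
      have j3 : Integrable (fun x => ψ x * (χ x * g x)) :=
        i2.bdd_mul hψ.continuous.aestronglyMeasurable (Eventually.of_forall hC)
      have e1 : (fun x => u x * fderiv ℝ (fun x => χ x * ψ x) x e) = fun x =>
          fderiv ℝ ψ x e * (χ x * u x) + ψ x * (fderiv ℝ χ x e * u x) := by
        ext x; rw [hd]; ring
      have e2 : (fun x => χ x * ψ x * g x) = fun x => ψ x * (χ x * g x) := by
        ext x; ring
      rw [e1, e2, integral_add j1 j2] at hp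
      have e3 : (fun x => ψ x * (χ x * g x + fderiv ℝ χ x e * u x)) = fun x =>
          ψ x * (χ x * g x) + ψ x * (fderiv ℝ χ x e * u x) := by
        ext x; ring
      have e4 : (fun x => χ x * u x * fderiv ℝ ψ x e) = fun x =>
          fderiv ℝ ψ x e * (χ x * u x) := by
        ext x; ring
      rw [e3, e4, integral_add j3 j2]
      linarith
    · intro x hx
      simp [hχ0 x hx]
    · intro x hx
      rw [hd, hχ0 x hx, hdχ0 x hx]
      simp

end LocalChainRule

/-! ### Weak gradients -/

section WeakGradient

open Filter Topology Metric

variable {d : ℕ} {T : Set (EuclideanSpace ℝ (Fin d) → ℝ)} {Ω : Set (EuclideanSpace ℝ (Fin d))}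
  {u : EuclideanSpace ℝ (Fin d) → ℝ} {G : EuclideanSpace ℝ (Fin d) → EuclideanSpace ℝ (Fin d)}

theorem isFiniteMeasure_restrict_of_isBounded (hΩ : Bornology.IsBounded Ω) :
    IsFiniteMeasure (volume.restrict Ω) :=
  ⟨by simpa using hΩ.measure_lt_top⟩

theorem ae_restrict_norm_le_of_continuous {F : Type*} [NormedAddCommGroup F]
    (hΩ : Bornology.IsBounded Ω) {f : EuclideanSpace ℝ (Fin d) → F} (hf : Continuous f) :
    ∃ C, ∀ᵐ x ∂volume.restrict Ω, ‖f x‖ ≤ C := by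
  obtain ⟨C, hC⟩ := hΩ.isCompact_closure.exists_bound_of_continuousOn hf.continuousOn
  refine ⟨C, ae_mono (Measure.restrict_mono subset_closure le_rfl) ?_⟩
  exact ae_restrict_of_forall_mem isClosed_closure.measurableSet hC

/-- On a bounded set, the vector identity defining the weak gradient may be tested direction by
direction. -/
theorem hasWeakGradient_iff (hT : ∀ φ ∈ T, ContDiff ℝ ∞ φ) (hΩ : Bornology.IsBounded Ω) :
    HasWeakGradient T Ω u G ↔ MemLp u 2 (volume.restrict Ω) ∧ MemLp G 2 (volume.restrict Ω) ∧
      ∀ φ ∈ T, ∀ e, ∫ x in Ω, u x * fderiv ℝ φ x e = -∫ x in Ω, φ x * ⟪G x, e⟫ := by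
  have := isFiniteMeasure_restrict_of_isBounded hΩ
  have key : ∀ (_ : MemLp u 2 (volume.restrict Ω)) (_ : MemLp G 2 (volume.restrict Ω)),
      ∀ φ ∈ T, ∀ e,
      ⟪∫ x in Ω, u x • ∇ φ x, e⟫ = ∫ x in Ω, u x * fderiv ℝ φ x e ∧
      ⟪∫ x in Ω, φ x • G x, e⟫ = ∫ x in Ω, φ x * ⟪G x, e⟫ := by
    intro hu hG φ hφ e
    have hs := hT φ hφ
    have hd : Continuous (fun x => ∇ φ x) :=
      (InnerProductSpace.toDual ℝ _).symm.continuous.comp (hs.continuous_fderiv (by simp))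
    obtain ⟨C, hC⟩ := ae_restrict_norm_le_of_continuous hΩ hd
    obtain ⟨M, hM⟩ := ae_restrict_norm_le_of_continuous hΩ hs.continuous
    have i1 : Integrable (fun x => u x • ∇ φ x) (volume.restrict Ω) :=
      (hu.integrable (by norm_num)).smul_bdd C hd.aestronglyMeasurable hC
    have i2 : Integrable (fun x => φ x • G x) (volume.restrict Ω) :=
      (hG.integrable (by norm_num)).bdd_smul M hs.continuous.aestronglyMeasurable hM
    rw [real_inner_comm, ← integral_inner i1, real_inner_comm, ← integral_inner i2]
    simp only [inner_smul_right]
    refine ⟨integral_congr_ae (Eventually.of_forall fun x => ?_),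
      integral_congr_ae (Eventually.of_forall fun x => ?_)⟩
    · dsimp only
      rw [real_inner_comm, ← InnerProductSpace.toDual_apply_apply (𝕜 := ℝ), toDual_gradient]
    · dsimp only
      rw [real_inner_comm]
  constructor
  · intro h
    refine ⟨h.memLp, h.memLp_grad, fun φ hφ e => ?_⟩
    obtain ⟨k1, k2⟩ := key h.memLp h.memLp_grad φ hφ e
    rw [← k1, ← k2, h.integral_eq φ hφ, inner_neg_left]
  · rintro ⟨h1, h2, h3⟩
    refine ⟨h1, h2, fun φ hφ => ?_⟩
    refine ext_inner_right ℝ fun e => ?_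
    obtain ⟨k1, k2⟩ := key h1 h2 φ hφ e
    rw [inner_neg_left, k1, k2, h3 φ hφ e]

/-- Composition with a `C¹` function of slope at most one is possible in the space given by the
test class `T`, with the usual chain rule. -/
def AdmitsChainRule (T : Set (EuclideanSpace ℝ (Fin d) → ℝ)) (Ω : Set (EuclideanSpace ℝ (Fin d))) :
    Prop :=
  ∀ u G, HasWeakGradient T Ω u G → ∀ F F' : ℝ → ℝ, (∀ t, HasDerivAt F (F' t) t) → Continuous F' →
    (∀ t, |F' t| ≤ 1) → F 0 = 0 →
    HasWeakGradient T Ω (fun x => F (u x)) (fun x => F' (u x) • G x)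

theorem memLp_comp_of_deriv_le_one {μ : Measure (EuclideanSpace ℝ (Fin d))} {F F' : ℝ → ℝ}
    (hF : ∀ t, HasDerivAt F (F' t) t) (hb : ∀ t, |F' t| ≤ 1) (h0 : F 0 = 0) (hu : MemLp u 2 μ) :
    MemLp (fun x => F (u x)) 2 μ := by
  have hFc : Continuous F := continuous_iff_continuousAt.2 fun t => (hF t).continuousAt
  refine hu.mono (hFc.comp_aestronglyMeasurable hu.aestronglyMeasurable)
    (Eventually.of_forall fun x => ?_)
  have := abs_sub_le_of_abs_deriv_le_one hF hb (u x) 0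
  simpa [h0] using this

theorem memLp_smul_of_abs_le_one {μ : Measure (EuclideanSpace ℝ (Fin d))} {F' : ℝ → ℝ}
    (hF'c : Continuous F') (hb : ∀ t, |F' t| ≤ 1) (hu : AEStronglyMeasurable u μ)
    (hG : MemLp G 2 μ) : MemLp (fun x => F' (u x) • G x) 2 μ := by
  refine hG.mono ((hF'c.comp_aestronglyMeasurable hu).smul hG.aestronglyMeasurable)
    (Eventually.of_forall fun x => ?_)
  rw [norm_smul, Real.norm_eq_abs]
  exact mul_le_of_le_one_left (norm_nonneg _) (hb _)

theorem admitsChainRule_compactTests (hΩ : IsOpen Ω) (hb : Bornology.IsBounded Ω) :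
    AdmitsChainRule (compactTests Ω) Ω := by
  have := isFiniteMeasure_restrict_of_isBounded hb
  intro u G h F F' hF hF'c hF' h0
  have hT : ∀ φ ∈ compactTests Ω, ContDiff ℝ ∞ φ := fun φ hφ => hφ.1
  rw [hasWeakGradient_iff hT hb] at h ⊢
  obtain ⟨h1, h2, h3⟩ := h
  refine ⟨memLp_comp_of_deriv_le_one hF hF' h0 h1,
    memLp_smul_of_abs_le_one hF'c hF' h1.aestronglyMeasurable h2, fun φ hφ e => ?_⟩
  have h1i : Integrable u (volume.restrict Ω) := h1.integrable (by norm_num)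
  have h2i : Integrable (fun x => ⟪G x, e⟫) (volume.restrict Ω) :=
    (h2.integrable (by norm_num)).inner_const e
  have := weak_chain_rule_on hΩ (u := u) (g := fun x => ⟪G x, e⟫) (e := e)
    (fun K hK _ => IntegrableOn.mono_set h1i hK) (fun K hK _ => IntegrableOn.mono_set h2i hK)
    (fun ψ a b c => h3 ψ ⟨a, b, c⟩ e) hF hF'c hF' hφ.1 hφ.2.1 hφ.2.2
  simpa [inner_smul_left] using this

end WeakGradient

/-! ### Periodization -/

section Periodization

open Filter Topology Metric

variable {d : ℕ}

/-- The period vector with integer coordinates `n` of the lattice generated by the edges of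
`openBox a b`. -/
noncomputable def latticeVec (a b : Fin d → ℝ) (n : Fin d → ℤ) : EuclideanSpace ℝ (Fin d) :=
  WithLp.toLp 2 fun i => n i * (b i - a i)

@[simp]
theorem latticeVec_apply (a b : Fin d → ℝ) (n : Fin d → ℤ) (i : Fin d) :
    latticeVec a b n i = n i * (b i - a i) := rfl

theorem latticeVec_add (a b : Fin d → ℝ) (m n : Fin d → ℤ) :
    latticeVec a b (m + n) = latticeVec a b m + latticeVec a b n := by
  ext i; simp [add_mul]

theorem latticeVec_neg (a b : Fin d → ℝ) (n : Fin d → ℤ) :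
    latticeVec a b (-n) = -latticeVec a b n := by
  ext i; simp

theorem latticeVec_single (a b : Fin d → ℝ) (i : Fin d) :
    latticeVec a b (Pi.single i 1) = EuclideanSpace.single i (b i - a i) := by
  ext j
  by_cases h : j = i
  · subst h; simp
  · simp [h]

/-- The half-open box, a fundamental domain for the translations by `latticeVec a b n`. -/
def halfOpenBox (a b : Fin d → ℝ) : Set (EuclideanSpace ℝ (Fin d)) :=
  {x | ∀ i, a i ≤ x i ∧ x i < b i}

/-- The index of the translate of the half-open box that contains `x`. -/
noncomputable def cellIndex (a b : Fin d → ℝ) (x : EuclideanSpace ℝ (Fin d)) : Fin d → ℤ :=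
  fun i => ⌊(x i - a i) / (b i - a i)⌋

/-- The representative of `x` in the half-open box. -/
noncomputable def cellRep (a b : Fin d → ℝ) (x : EuclideanSpace ℝ (Fin d)) :
    EuclideanSpace ℝ (Fin d) :=
  x - latticeVec a b (cellIndex a b x)

variable {a b : Fin d → ℝ}

theorem measurableSet_halfOpenBox : MeasurableSet (halfOpenBox a b) := by
  have : halfOpenBox a b = ⋂ i, {x | a i ≤ x i ∧ x i < b i} := by
    ext x; simp [halfOpenBox]
  rw [this]
  refine MeasurableSet.iInter fun i => ?_
  have hi : Measurable fun x : EuclideanSpace ℝ (Fin d) => x i :=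
    (EuclideanSpace.proj (𝕜 := ℝ) i).continuous.measurable
  exact (measurableSet_le measurable_const hi).inter (measurableSet_lt hi measurable_const)

theorem isBounded_of_coord_mem {s : Set (EuclideanSpace ℝ (Fin d))}
    (h : ∀ x ∈ s, ∀ i, a i ≤ x i ∧ x i ≤ b i) : Bornology.IsBounded s := by
  have h1 : Bornology.IsBounded ((WithLp.equiv 2 (Fin d → ℝ)) ⁻¹' Set.Icc a b) :=
    (PiLp.antilipschitzWith_ofLp 2 (fun _ : Fin d => ℝ)).isBounded_preimage
      (Metric.isBounded_Icc a b)
  exact h1.subset fun x hx => ⟨fun i => (h x hx i).1, fun i => (h x hx i).2⟩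

theorem isBounded_halfOpenBox : Bornology.IsBounded (halfOpenBox a b) :=
  isBounded_of_coord_mem fun _ hx i => ⟨(hx i).1, (hx i).2.le⟩

theorem isBounded_openBox : Bornology.IsBounded (openBox a b) :=
  isBounded_of_coord_mem fun _ hx i => ⟨(hx i).1.le, (hx i).2.le⟩

theorem isOpen_openBox : IsOpen (openBox a b) := by
  have : openBox a b = ⋂ i, {x | a i < x i ∧ x i < b i} := by
    ext x; simp [openBox]
  rw [this]
  refine isOpen_iInter_of_finite fun i => ?_
  have hi : Continuous fun x : EuclideanSpace ℝ (Fin d) => x i :=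
    (EuclideanSpace.proj (𝕜 := ℝ) i).continuous
  exact (isOpen_lt continuous_const hi).inter (isOpen_lt hi continuous_const)

theorem openBox_subset_halfOpenBox : openBox a b ⊆ halfOpenBox a b :=
  fun _ hx i => ⟨(hx i).1.le, (hx i).2⟩

theorem openBox_ae_eq_halfOpenBox : openBox a b =ᵐ[volume] halfOpenBox a b := by
  have h : (Set.univ.pi fun i => Set.Ioo (a i) (b i)) =ᵐ[volume]
      (Set.univ.pi fun i => Set.Ico (a i) (b i)) :=
    (Measure.univ_pi_Ioo_ae_eq_Icc (μ := fun _ : Fin d => (volume : Measure ℝ))).trans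
      (Measure.univ_pi_Ico_ae_eq_Icc (μ := fun _ : Fin d => (volume : Measure ℝ))).symm
  have := (PiLp.volume_preserving_ofLp (Fin d)).quasiMeasurePreserving.preimage_ae_eq h
  have e1 : openBox a b = WithLp.ofLp ⁻¹' Set.univ.pi fun i => Set.Ioo (a i) (b i) := by
    ext x; simp [openBox]
  have e2 : halfOpenBox a b = WithLp.ofLp ⁻¹' Set.univ.pi fun i => Set.Ico (a i) (b i) := by
    ext x; simp [halfOpenBox]
  rwa [e1, e2]

theorem cellIndex_add (hab : ∀ i, a i < b i) (x : EuclideanSpace ℝ (Fin d)) (n : Fin d → ℤ) :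
    cellIndex a b (x + latticeVec a b n) = cellIndex a b x + n := by
  ext i
  have : b i - a i ≠ 0 := (sub_pos.2 (hab i)).ne'
  have h : (x i + n i * (b i - a i) - a i) / (b i - a i) = (x i - a i) / (b i - a i) + n i := by
    field_simp
    ring
  simp [cellIndex, h]

theorem cellIndex_eq_zero_iff (hab : ∀ i, a i < b i) (x : EuclideanSpace ℝ (Fin d)) :
    cellIndex a b x = 0 ↔ x ∈ halfOpenBox a b := by
  rw [funext_iff]
  refine forall_congr' fun i => ?_
  have : 0 < b i - a i := sub_pos.2 (hab i)
  simp only [cellIndex, Pi.zero_apply, Int.floor_eq_zero_iff, Set.mem_Ico]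
  rw [div_lt_one this, le_div_iff₀ this]
  constructor <;> rintro ⟨h1, h2⟩ <;> constructor <;> linarith

theorem cellRep_add (hab : ∀ i, a i < b i) (x : EuclideanSpace ℝ (Fin d)) (n : Fin d → ℤ) :
    cellRep a b (x + latticeVec a b n) = cellRep a b x := by
  rw [cellRep, cellRep, cellIndex_add hab, latticeVec_add]
  abel

theorem cellRep_mem (hab : ∀ i, a i < b i) (x : EuclideanSpace ℝ (Fin d)) :
    cellRep a b x ∈ halfOpenBox a b := by
  rw [← cellIndex_eq_zero_iff hab, cellRep, sub_eq_add_neg, ← latticeVec_neg, cellIndex_add hab,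
    add_neg_cancel]

theorem cellRep_of_mem (hab : ∀ i, a i < b i) {x : EuclideanSpace ℝ (Fin d)}
    (hx : x ∈ halfOpenBox a b) : cellRep a b x = x := by
  rw [cellRep, (cellIndex_eq_zero_iff hab x).2 hx]
  ext i; simp

theorem finite_setOf_norm_latticeVec_le (hab : ∀ i, a i < b i) (R : ℝ) :
    {n : Fin d → ℤ | ‖latticeVec a b n‖ ≤ R}.Finite := by
  refine (Set.Finite.pi' fun i : Fin d =>
    Set.finite_Icc (-⌈R / (b i - a i)⌉) ⌈R / (b i - a i)⌉).subset fun n hn i => ?_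
  have hL : 0 < b i - a i := sub_pos.2 (hab i)
  have h1 : |(n i : ℝ)| * (b i - a i) ≤ R := by
    have := (PiLp.norm_apply_le (latticeVec a b n) i).trans hn
    rwa [latticeVec_apply, Real.norm_eq_abs, abs_mul, abs_of_pos hL] at this
  have h2 : |(n i : ℝ)| ≤ ⌈R / (b i - a i)⌉ := ((le_div_iff₀ hL).2 h1).trans (Int.le_ceil _)
  have h3 : |n i| ≤ ⌈R / (b i - a i)⌉ := by exact_mod_cast h2
  exact abs_le.1 h3

/-- Only finitely many lattice translates of a bounded set meet a given ball. -/
theorem exists_finset_translates (hab : ∀ i, a i < b i) (R R' : ℝ) :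
    ∃ S : Finset (Fin d → ℤ), ∀ n ∉ S, ∀ x : EuclideanSpace ℝ (Fin d), ‖x‖ ≤ R →
      R' < ‖x + latticeVec a b n‖ := by
  refine ⟨(finite_setOf_norm_latticeVec_le hab (R + R')).toFinset, fun n hn x hx => ?_⟩
  simp only [Set.Finite.mem_toFinset, Set.mem_ofPred_eq, not_le] at hn
  have := norm_sub_le (x + latticeVec a b n) x
  rw [add_sub_cancel_left] at this
  linarith

theorem exists_finset_eq_zero (hab : ∀ i, a i < b i) {ψ : EuclideanSpace ℝ (Fin d) → ℝ}
    (hψ : HasCompactSupport ψ) (R : ℝ) :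
    ∃ S : Finset (Fin d → ℤ), ∀ n ∉ S, ∀ x : EuclideanSpace ℝ (Fin d), ‖x‖ ≤ R →
      ψ (x + latticeVec a b n) = 0 := by
  obtain ⟨R', hR'⟩ := hψ.isCompact.isBounded.exists_norm_le
  obtain ⟨S, hS⟩ := exists_finset_translates hab R R'
  refine ⟨S, fun n hn x hx => ?_⟩
  by_contra h
  exact (hS n hn x hx).not_ge (hR' _ (subset_tsupport _ h))

/-- The sum of all lattice translates of `ψ`. -/
noncomputable def periodize (a b : Fin d → ℝ) (ψ : EuclideanSpace ℝ (Fin d) → ℝ)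
    (x : EuclideanSpace ℝ (Fin d)) : ℝ :=
  ∑' n : Fin d → ℤ, ψ (x + latticeVec a b n)

theorem periodize_add (ψ : EuclideanSpace ℝ (Fin d) → ℝ) (x : EuclideanSpace ℝ (Fin d))
    (m : Fin d → ℤ) : periodize a b ψ (x + latticeVec a b m) = periodize a b ψ x := by
  unfold periodize
  rw [← (Equiv.addLeft m).tsum_eq fun n => ψ (x + latticeVec a b n)]
  simp [latticeVec_add, add_assoc]

theorem exists_periodize_eq_sum (hab : ∀ i, a i < b i) {ψ : EuclideanSpace ℝ (Fin d) → ℝ}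
    (hψ : HasCompactSupport ψ) (R : ℝ) :
    ∃ S : Finset (Fin d → ℤ), (∀ n ∉ S, ∀ x : EuclideanSpace ℝ (Fin d), ‖x‖ ≤ R →
      ψ (x + latticeVec a b n) = 0) ∧ ∀ x : EuclideanSpace ℝ (Fin d), ‖x‖ ≤ R →
      periodize a b ψ x = ∑ n ∈ S, ψ (x + latticeVec a b n) := by
  obtain ⟨S, hS⟩ := exists_finset_eq_zero hab hψ R
  exact ⟨S, hS, fun x hx => tsum_eq_sum fun n hn => hS n hn x hx⟩

theorem eventuallyEq_periodize (hab : ∀ i, a i < b i) {ψ : EuclideanSpace ℝ (Fin d) → ℝ}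
    (hψ : HasCompactSupport ψ) (x : EuclideanSpace ℝ (Fin d)) :
    ∃ S : Finset (Fin d → ℤ), (∀ n ∉ S, ∀ᶠ y in 𝓝 x, ψ (y + latticeVec a b n) = 0) ∧
      periodize a b ψ =ᶠ[𝓝 x] fun y => ∑ n ∈ S, ψ (y + latticeVec a b n) := by
  obtain ⟨S, hS0, hS⟩ := exists_periodize_eq_sum hab hψ (‖x‖ + 1)
  have : ∀ᶠ y in 𝓝 x, ‖y‖ ≤ ‖x‖ + 1 := by
    filter_upwards [(continuous_norm.tendsto x).eventually (gt_mem_nhds (lt_add_one ‖x‖))] with y hy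
    exact hy.le
  exact ⟨S, fun n hn => this.mono fun y hy => hS0 n hn y hy, this.mono fun y hy => hS y hy⟩

theorem contDiff_periodize (hab : ∀ i, a i < b i) {ψ : EuclideanSpace ℝ (Fin d) → ℝ}
    (hψ : ContDiff ℝ ∞ ψ) (hψc : HasCompactSupport ψ) : ContDiff ℝ ∞ (periodize a b ψ) := by
  rw [contDiff_iff_contDiffAt]
  intro x
  obtain ⟨S, -, hS⟩ := eventuallyEq_periodize hab hψc x
  refine ContDiffAt.congr_of_eventuallyEq ?_ hS
  refine (ContDiff.sum fun n _ => ?_).contDiffAt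
  exact hψ.comp (contDiff_id.add contDiff_const)

theorem periodize_mem_periodicTests (hab : ∀ i, a i < b i) {ψ : EuclideanSpace ℝ (Fin d) → ℝ}
    (hψ : ContDiff ℝ ∞ ψ) (hψc : HasCompactSupport ψ) : periodize a b ψ ∈ periodicTests a b := by
  refine ⟨contDiff_periodize hab hψ hψc, fun x i => ?_⟩
  rw [← latticeVec_single, periodize_add]

theorem fderiv_periodize (hab : ∀ i, a i < b i) {ψ : EuclideanSpace ℝ (Fin d) → ℝ}
    (hψ : ContDiff ℝ ∞ ψ) (hψc : HasCompactSupport ψ) (x e : EuclideanSpace ℝ (Fin d)) :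
    fderiv ℝ (periodize a b ψ) x e = periodize a b (fun y => fderiv ℝ ψ y e) x := by
  obtain ⟨S, hS0, hS⟩ := eventuallyEq_periodize hab hψc x
  have hd : ∀ n, fderiv ℝ (fun y => ψ (y + latticeVec a b n)) x =
      fderiv ℝ ψ (x + latticeVec a b n) := fun n => fderiv_comp_add_right _
  rw [hS.fderiv_eq, fderiv_fun_sum, _root_.sum_apply, periodize, tsum_eq_sum (s := S)]
  · simp_rw [hd]
  · intro n hn
    have : (fun y => ψ (y + latticeVec a b n)) =ᶠ[𝓝 x] fun _ => 0 := hS0 n hn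
    rw [← hd, this.fderiv_eq]
    simp
  · intro n _
    exact (hψ.comp (contDiff_id.add contDiff_const)).differentiable (by simp) x

variable {h : EuclideanSpace ℝ (Fin d) → ℝ}

theorem preimage_cell (hab : ∀ i, a i < b i) (n : Fin d → ℤ) :
    (fun x => x + latticeVec a b n) ⁻¹' {x | cellIndex a b x = n} = halfOpenBox a b := by
  ext x
  rw [← cellIndex_eq_zero_iff hab]
  simp [cellIndex_add hab]

theorem cell_eq_preimage (hab : ∀ i, a i < b i) (n : Fin d → ℤ) :
    {x | cellIndex a b x = n} = (fun x => x + latticeVec a b (-n)) ⁻¹' halfOpenBox a b := by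
  ext x
  rw [Set.mem_preimage, ← cellIndex_eq_zero_iff hab, cellIndex_add hab]
  simp [add_neg_eq_zero]

theorem measurableSet_cell (hab : ∀ i, a i < b i) (n : Fin d → ℤ) :
    MeasurableSet {x | cellIndex a b x = n} := by
  rw [cell_eq_preimage hab]
  exact (measurable_add_const _) measurableSet_halfOpenBox

theorem integrableOn_cell (hab : ∀ i, a i < b i) (hp : ∀ x n, h (x + latticeVec a b n) = h x)
    (hi : IntegrableOn h (halfOpenBox a b)) (n : Fin d → ℤ) :
    IntegrableOn h {x | cellIndex a b x = n} := by
  rw [← (measurePreserving_add_right volume (latticeVec a b n)).integrableOn_comp_preimage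
    (measurableEmbedding_addRight _), preimage_cell hab]
  exact hi.congr (Eventually.of_forall fun x => (hp x n).symm)

theorem exists_finset_cells (hab : ∀ i, a i < b i) (R : ℝ) :
    ∃ S : Finset (Fin d → ℤ), ∀ x : EuclideanSpace ℝ (Fin d), ‖x‖ ≤ R → cellIndex a b x ∈ S := by
  obtain ⟨R', hR'⟩ := (isBounded_halfOpenBox (a := a) (b := b)).exists_norm_le
  obtain ⟨S, hS⟩ := exists_finset_translates hab R' R
  refine ⟨S, fun x hx => ?_⟩
  by_contra hn
  refine (hS _ hn (cellRep a b x) (hR' _ (cellRep_mem hab x))).not_ge ?_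
  simpa [cellRep] using hx

/-- A periodic function that is integrable on one cell is integrable on every bounded set. -/
theorem integrableOn_of_periodic (hab : ∀ i, a i < b i)
    (hp : ∀ x n, h (x + latticeVec a b n) = h x) (hi : IntegrableOn h (halfOpenBox a b))
    {K : Set (EuclideanSpace ℝ (Fin d))} (hK : Bornology.IsBounded K) : IntegrableOn h K := by
  obtain ⟨R, hR⟩ := hK.exists_norm_le
  obtain ⟨S, hS⟩ := exists_finset_cells hab R
  have : IntegrableOn h (⋃ n ∈ S, {x | cellIndex a b x = n}) :=
    integrableOn_finset_iUnion.2 fun n _ => integrableOn_cell hab hp hi n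
  refine this.mono_set fun x hx => ?_
  simpa using hS x (hR x hx)

/-- Unfolding: the integral of a periodic function against `ψ` over the whole space is its integral
against the periodization of `ψ` over one cell. -/
theorem integral_mul_eq_setIntegral_mul_periodize (hab : ∀ i, a i < b i)
    (hp : ∀ x n, h (x + latticeVec a b n) = h x) (hi : IntegrableOn h (openBox a b))
    {ψ : EuclideanSpace ℝ (Fin d) → ℝ} (hψ : Continuous ψ) (hψc : HasCompactSupport ψ) :
    ∫ x, h x * ψ x = ∫ x in openBox a b, h x * periodize a b ψ x := by
  rw [integrableOn_congr_set_ae openBox_ae_eq_halfOpenBox] at hi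
  rw [setIntegral_congr_set openBox_ae_eq_halfOpenBox]
  obtain ⟨M, hM⟩ := hψc.exists_bound_of_continuous hψ
  obtain ⟨R, hR⟩ := (isBounded_halfOpenBox (a := a) (b := b)).exists_norm_le
  obtain ⟨S, hS0, hS⟩ := exists_periodize_eq_sum hab hψc R
  have hzero : ∀ x ∉ ⋃ n ∈ S, {x | cellIndex a b x = n}, h x * ψ x = 0 := by
    intro x hx
    have hn : cellIndex a b x ∉ S := by simpa using hx
    have := hS0 _ hn (cellRep a b x) (hR _ (cellRep_mem hab x))
    rw [cellRep, sub_add_cancel] at this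
    rw [this, mul_zero]
  rw [← setIntegral_eq_integral_of_forall_compl_eq_zero hzero,
    integral_biUnion_finset S (fun n _ => measurableSet_cell hab n)]
  · have hsum : ∀ x ∈ halfOpenBox a b, h x * periodize a b ψ x =
        ∑ n ∈ S, h x * ψ (x + latticeVec a b n) := fun x hx => by
      rw [hS x (hR x hx), Finset.mul_sum]
    rw [setIntegral_congr_fun measurableSet_halfOpenBox hsum, integral_finsetSum]
    · refine Finset.sum_congr rfl fun n _ => ?_
      rw [← (measurePreserving_add_right volume (latticeVec a b n)).setIntegral_preimage_emb
        (measurableEmbedding_addRight _), preimage_cell hab]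
      simp_rw [hp]
    · intro n _
      exact Integrable.mul_bdd (c := M) hi (hψ.comp (continuous_add_const _)).aestronglyMeasurable
        (Eventually.of_forall fun x => hM _)
  · intro m _ n _ hmn
    refine Set.disjoint_left.2 fun x hx hx' => hmn ?_
    exact (show cellIndex a b x = m from hx).symm.trans hx'
  · intro n _
    exact Integrable.mul_bdd (c := M) (integrableOn_cell hab hp hi n) hψ.aestronglyMeasurable
      (Eventually.of_forall hM)

theorem add_latticeVec_of_mem_periodicTests {φ : EuclideanSpace ℝ (Fin d) → ℝ}
    (hφ : φ ∈ periodicTests a b) (x : EuclideanSpace ℝ (Fin d)) (n : Fin d → ℤ) :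
    φ (x + latticeVec a b n) = φ x := by
  have h1 : latticeVec a b n = ∑ i, n i • EuclideanSpace.single i (b i - a i) := by
    ext j
    simp [Finset.sum_apply, Pi.single_apply]
  have h2 : ∀ s : Finset (Fin d), Function.Periodic φ
      (∑ i ∈ s, n i • EuclideanSpace.single i (b i - a i)) := by
    intro s
    induction s using Finset.induction_on with
    | empty => simp [Function.Periodic]
    | insert i s hi ih =>
      rw [Finset.sum_insert hi]
      have h3 : Function.Periodic φ (EuclideanSpace.single i (b i - a i)) := fun x => hφ.2 x i
      exact (h3.zsmul (n i)).add_period ih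
  rw [h1]
  exact h2 Finset.univ x

/-- Every smooth periodic function is the periodization of a smooth function with compact
support. -/
theorem exists_periodize_eq (hab : ∀ i, a i < b i) {φ : EuclideanSpace ℝ (Fin d) → ℝ}
    (hφ : φ ∈ periodicTests a b) :
    ∃ ψ : EuclideanSpace ℝ (Fin d) → ℝ, ContDiff ℝ ∞ ψ ∧ HasCompactSupport ψ ∧
      periodize a b ψ = φ := by
  obtain ⟨χ, hχ, hχc, -, hχ1⟩ := exists_smooth_cutoff isOpen_univ
    (isBounded_halfOpenBox (a := a) (b := b)).isCompact_closure (Set.subset_univ _)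
  -- the square is nonnegative, so its periodization is at least its value in the cell
  set θ : EuclideanSpace ℝ (Fin d) → ℝ := fun x => χ x * χ x
  have hθ : ContDiff ℝ ∞ θ := hχ.mul hχ
  have hθc : HasCompactSupport θ := hχc.mul_left
  have hpos : ∀ x, periodize a b θ x ≠ 0 := by
    intro x
    have h1 : θ (x + latticeVec a b (-cellIndex a b x)) = 1 := by
      have := (hχ1 _ (subset_closure (cellRep_mem hab x))).self_of_nhds
      rw [latticeVec_neg, ← sub_eq_add_neg]
      simp only [cellRep] at this
      simp [θ, this]
    obtain ⟨S, hS0, hS⟩ := exists_periodize_eq_sum hab hθc ‖x‖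
    have hmem : -cellIndex a b x ∈ S := by
      by_contra hn
      have := hS0 _ hn x le_rfl
      rw [h1] at this
      exact one_ne_zero this
    have := Finset.single_le_sum (f := fun n => θ (x + latticeVec a b n))
      (fun n _ => mul_self_nonneg _) hmem
    rw [hS x le_rfl]
    simp only [h1] at this
    linarith
  refine ⟨fun x => φ x / periodize a b θ x * θ x,
    (hφ.1.div (contDiff_periodize hab hθ hθc) hpos).mul hθ, hθc.mul_left, ?_⟩
  ext x
  have : ∀ n, φ (x + latticeVec a b n) / periodize a b θ (x + latticeVec a b n) *
      θ (x + latticeVec a b n) = φ x / periodize a b θ x * θ (x + latticeVec a b n) := fun n => by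
    rw [periodize_add, add_latticeVec_of_mem_periodicTests hφ]
  rw [periodize]
  simp_rw [this]
  rw [tsum_mul_left]
  exact div_mul_cancel₀ _ (hpos x)

end Periodization

/-! ### The chain rule for periodic functions -/

section PeriodicChainRule

open Filter Topology Metric

variable {d : ℕ} {a b : Fin d → ℝ} {u g : EuclideanSpace ℝ (Fin d) → ℝ}
  {e : EuclideanSpace ℝ (Fin d)}

theorem setIntegral_comp_cellRep (hab : ∀ i, a i < b i)
    (f : EuclideanSpace ℝ (Fin d) → EuclideanSpace ℝ (Fin d) → ℝ) :
    ∫ x in openBox a b, f (cellRep a b x) x = ∫ x in openBox a b, f x x :=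
  setIntegral_congr_fun isOpen_openBox.measurableSet fun x hx => by
    rw [cellRep_of_mem hab (openBox_subset_halfOpenBox hx)]

theorem integrableOn_comp_cellRep (hab : ∀ i, a i < b i) (hu : IntegrableOn u (openBox a b)) :
    IntegrableOn (fun x => u (cellRep a b x)) (openBox a b) :=
  hu.congr_fun (fun x hx => by
    rw [cellRep_of_mem hab (openBox_subset_halfOpenBox hx)]) isOpen_openBox.measurableSet

/-- A weak derivative in the periodic sense extends periodically to a weak derivative in the whole
space. -/
theorem integral_cellRep_mul_fderiv (hab : ∀ i, a i < b i) (hu : IntegrableOn u (openBox a b))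
    (hg : IntegrableOn g (openBox a b))
    (h : ∀ φ ∈ periodicTests a b,
      ∫ x in openBox a b, u x * fderiv ℝ φ x e = -∫ x in openBox a b, φ x * g x)
    {ψ : EuclideanSpace ℝ (Fin d) → ℝ} (hψ : ContDiff ℝ ∞ ψ) (hψc : HasCompactSupport ψ) :
    ∫ x, u (cellRep a b x) * fderiv ℝ ψ x e = -∫ x, ψ x * g (cellRep a b x) := by
  have hp : ∀ (k : EuclideanSpace ℝ (Fin d) → ℝ) x n,
      k (cellRep a b (x + latticeVec a b n)) = k (cellRep a b x) := fun k x n => by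
    rw [cellRep_add hab]
  have hd : Continuous fun x => fderiv ℝ ψ x e :=
    (hψ.continuous_fderiv (by simp)).clm_apply continuous_const
  simp_rw [mul_comm (ψ _)]
  rw [integral_mul_eq_setIntegral_mul_periodize hab (hp u) (integrableOn_comp_cellRep hab hu) hd
      (hψc.fderiv_apply ℝ e),
    integral_mul_eq_setIntegral_mul_periodize hab (hp g) (integrableOn_comp_cellRep hab hg)
      hψ.continuous hψc,
    setIntegral_comp_cellRep hab (fun y x => u y * periodize a b (fun y => fderiv ℝ ψ y e) x),
    setIntegral_comp_cellRep hab (fun y x => g y * periodize a b ψ x)]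
  simp_rw [← fderiv_periodize hab hψ hψc]
  rw [h _ (periodize_mem_periodicTests hab hψ hψc)]
  simp_rw [mul_comm]

/-- The chain rule for periodic weak derivatives. -/
theorem periodic_chain_rule (hab : ∀ i, a i < b i) (hu : IntegrableOn u (openBox a b))
    (hg : IntegrableOn g (openBox a b))
    (h : ∀ φ ∈ periodicTests a b,
      ∫ x in openBox a b, u x * fderiv ℝ φ x e = -∫ x in openBox a b, φ x * g x)
    {F F' : ℝ → ℝ} (hF : ∀ t, HasDerivAt F (F' t) t) (hF'c : Continuous F')
    (hb : ∀ t, |F' t| ≤ 1) (hFu : IntegrableOn (fun x => F (u x)) (openBox a b))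
    (hFg : IntegrableOn (fun x => F' (u x) * g x) (openBox a b))
    {φ : EuclideanSpace ℝ (Fin d) → ℝ} (hφ : φ ∈ periodicTests a b) :
    ∫ x in openBox a b, F (u x) * fderiv ℝ φ x e =
      -∫ x in openBox a b, φ x * (F' (u x) * g x) := by
  have hp : ∀ (k : EuclideanSpace ℝ (Fin d) → ℝ) x n,
      k (cellRep a b (x + latticeVec a b n)) = k (cellRep a b x) := fun k x n => by
    rw [cellRep_add hab]
  have hloc : ∀ k : EuclideanSpace ℝ (Fin d) → ℝ, IntegrableOn k (openBox a b) →
      ∀ K : Set (EuclideanSpace ℝ (Fin d)), K ⊆ Set.univ → IsCompact K →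
        IntegrableOn (fun x => k (cellRep a b x)) K := by
    intro k hk K _ hK
    refine integrableOn_of_periodic hab (hp k) ?_ hK.isBounded
    rw [← integrableOn_congr_set_ae openBox_ae_eq_halfOpenBox]
    exact integrableOn_comp_cellRep hab hk
  obtain ⟨ψ, hψ, hψc, rfl⟩ := exists_periodize_eq hab hφ
  have key := weak_chain_rule_on isOpen_univ (hloc u hu) (hloc g hg)
    (fun ψ h1 h2 _ => by
      simpa using integral_cellRep_mul_fderiv hab hu hg h h1 h2) hF hF'c hb hψ hψc
    (Set.subset_univ _)
  simp only [Measure.restrict_univ] at key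
  have hd : Continuous fun x => fderiv ℝ ψ x e :=
    (hψ.continuous_fderiv (by simp)).clm_apply continuous_const
  simp_rw [mul_comm (ψ _)] at key
  rw [integral_mul_eq_setIntegral_mul_periodize hab (hp fun y => F (u y))
      (integrableOn_comp_cellRep hab hFu) hd (hψc.fderiv_apply ℝ e),
    integral_mul_eq_setIntegral_mul_periodize hab (hp fun y => F' (u y) * g y)
      (integrableOn_comp_cellRep hab hFg) hψ.continuous hψc,
    setIntegral_comp_cellRep hab (fun y x => F (u y) * periodize a b (fun y => fderiv ℝ ψ y e) x),
    setIntegral_comp_cellRep hab (fun y x => F' (u y) * g y * periodize a b ψ x)] at key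
  simp_rw [fderiv_periodize hab hψ hψc, mul_comm (periodize a b ψ _)]
  exact key

theorem admitsChainRule_periodicTests (hab : ∀ i, a i < b i) :
    AdmitsChainRule (periodicTests a b) (openBox a b) := by
  have hbd : Bornology.IsBounded (openBox a b) := isBounded_openBox
  have := isFiniteMeasure_restrict_of_isBounded hbd
  intro u G h F F' hF hF'c hF' h0
  have hT : ∀ φ ∈ periodicTests a b, ContDiff ℝ ∞ φ := fun φ hφ => hφ.1
  rw [hasWeakGradient_iff hT hbd] at h ⊢
  obtain ⟨h1, h2, h3⟩ := h
  have m1 := memLp_comp_of_deriv_le_one hF hF' h0 h1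
  have m2 := memLp_smul_of_abs_le_one hF'c hF' h1.aestronglyMeasurable h2
  refine ⟨m1, m2, fun φ hφ e => ?_⟩
  have h2i : Integrable (fun x => ⟪G x, e⟫) (volume.restrict (openBox a b)) :=
    (h2.integrable (by norm_num)).inner_const e
  have m2i : Integrable (fun x => F' (u x) * ⟪G x, e⟫) (volume.restrict (openBox a b)) := by
    simpa [inner_smul_left] using (m2.integrable (by norm_num)).inner_const (𝕜 := ℝ) e
  have := periodic_chain_rule hab (h1.integrable (by norm_num)) h2i (fun ψ hψ => h3 ψ hψ e)
    hF hF'c hF' (m1.integrable (by norm_num)) m2i hφ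
  simpa [inner_smul_left] using this

/-- A periodic weak gradient is a weak gradient in the cell. -/
theorem HasWeakGradient.compactTests_of_periodicTests (hab : ∀ i, a i < b i)
    {G : EuclideanSpace ℝ (Fin d) → EuclideanSpace ℝ (Fin d)}
    (h : HasWeakGradient (periodicTests a b) (openBox a b) u G) :
    HasWeakGradient (compactTests (openBox a b)) (openBox a b) u G := by
  have hbd : Bornology.IsBounded (openBox a b) := isBounded_openBox
  have := isFiniteMeasure_restrict_of_isBounded hbd
  rw [hasWeakGradient_iff (fun φ hφ => hφ.1) hbd] at h ⊢
  obtain ⟨h1, h2, h3⟩ := h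
  refine ⟨h1, h2, fun φ hφ e => ?_⟩
  have h2i : Integrable (fun x => ⟪G x, e⟫) (volume.restrict (openBox a b)) :=
    (h2.integrable (by norm_num)).inner_const e
  have key := integral_cellRep_mul_fderiv hab (h1.integrable (by norm_num)) h2i
    (fun ψ hψ => h3 ψ hψ e) hφ.1 hφ.2.1
  rw [← setIntegral_eq_integral_of_eq_zero (Ω := openBox a b),
    ← setIntegral_eq_integral_of_eq_zero (Ω := openBox a b),
    setIntegral_comp_cellRep hab (fun y x => u y * fderiv ℝ φ x e),
    setIntegral_comp_cellRep hab (fun y x => φ x * inner ℝ (G y) e)] at key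
  · exact key
  · intro x hx
    rw [image_eq_zero_of_notMem_tsupport fun h => hx (hφ.2.2 h), zero_mul]
  · intro x hx
    have : fderiv ℝ φ x e = 0 := image_eq_zero_of_notMem_tsupport
      (f := fun x => fderiv ℝ φ x e) fun h => hx (hφ.2.2 (tsupport_fderiv_apply_subset ℝ e h))
    rw [this, mul_zero]

end PeriodicChainRule

/-! ### The potential estimate -/

section Representation

open Filter Topology Metric

variable {d : ℕ}

/-- The dilation of `ζ` about `x` by the factor `exp (-s)`, normalised so as to preserve its
integral. -/
noncomputable def dilate (ζ : EuclideanSpace ℝ (Fin d) → ℝ) (x : EuclideanSpace ℝ (Fin d))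
    (s : ℝ) (y : EuclideanSpace ℝ (Fin d)) : ℝ :=
  Real.exp s ^ d * ζ (Real.exp s • (y - x))

/-- The derivative of `dilate ζ x s y` in `s`. -/
noncomputable def dilateDeriv (ζ : EuclideanSpace ℝ (Fin d) → ℝ) (x : EuclideanSpace ℝ (Fin d))
    (s : ℝ) (y : EuclideanSpace ℝ (Fin d)) : ℝ :=
  Real.exp s ^ d * (d * ζ (Real.exp s • (y - x)) +
    fderiv ℝ ζ (Real.exp s • (y - x)) (Real.exp s • (y - x)))

variable {ζ : EuclideanSpace ℝ (Fin d) → ℝ} {x : EuclideanSpace ℝ (Fin d)}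

theorem hasDerivAt_dilate (hζ : ContDiff ℝ ∞ ζ) (y : EuclideanSpace ℝ (Fin d)) (s : ℝ) :
    HasDerivAt (fun s => dilate ζ x s y) (dilateDeriv ζ x s y) s := by
  have h1 : HasDerivAt (fun s => Real.exp s • (y - x)) (Real.exp s • (y - x)) s :=
    (Real.hasDerivAt_exp s).smul_const _
  have h2 := ((hζ.differentiable (by simp) _).hasFDerivAt).comp_hasDerivAt s h1
  have h3 : HasDerivAt (fun s => Real.exp s ^ d) (d * Real.exp s ^ d) s := by
    have : (fun s => Real.exp s ^ d) = fun s => Real.exp (d * s) := by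
      ext s; rw [Real.exp_nat_mul]
    rw [this, ← Real.exp_nat_mul, mul_comm]
    simpa using ((hasDerivAt_id s).const_mul (d : ℝ)).exp
  have h4 : HasDerivAt (fun s => dilate ζ x s y) _ s := h3.mul h2
  refine h4.congr_deriv ?_
  simp only [dilateDeriv]
  ring

theorem contDiff_dilate (hζ : ContDiff ℝ ∞ ζ) (s : ℝ) : ContDiff ℝ ∞ (dilate ζ x s) := by
  have h : ContDiff ℝ ∞ fun y : EuclideanSpace ℝ (Fin d) => Real.exp s • (y - x) :=
    (contDiff_id.sub contDiff_const).const_smul (Real.exp s)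
  exact contDiff_const.mul (hζ.comp h)

theorem continuous_dilateDeriv (hζ : ContDiff ℝ ∞ ζ) :
    Continuous fun p : EuclideanSpace ℝ (Fin d) × ℝ => dilateDeriv ζ x p.2 p.1 := by
  have h1 : Continuous fun p : EuclideanSpace ℝ (Fin d) × ℝ => Real.exp p.2 • (p.1 - x) := by
    fun_prop
  have h2 : Continuous ζ := hζ.continuous
  have h3 : Continuous (fderiv ℝ ζ) := hζ.continuous_fderiv (by simp)
  unfold dilateDeriv
  exact ((Real.continuous_exp.comp continuous_snd).pow d).mul
    ((continuous_const.mul (h2.comp h1)).add ((h3.comp h1).clm_apply h1))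

theorem continuous_dilate (hζ : Continuous ζ) :
    Continuous fun p : EuclideanSpace ℝ (Fin d) × ℝ => dilate ζ x p.2 p.1 := by
  unfold dilate
  fun_prop

/-- The derivative of the dilations is a divergence: `∂ₛ kₛ = div ((y - x) kₛ)`. -/
theorem sum_fderiv_coord_mul_dilate (hζ : ContDiff ℝ ∞ ζ) (s : ℝ)
    (y : EuclideanSpace ℝ (Fin d)) :
    ∑ i, fderiv ℝ (fun y : EuclideanSpace ℝ (Fin d) => (y i - x i) * dilate ζ x s y) y
      (EuclideanSpace.single i 1) = dilateDeriv ζ x s y := by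
  have hk : HasFDerivAt (dilate ζ x s)
      (Real.exp s ^ d • (fderiv ℝ ζ (Real.exp s • (y - x))).comp
        (Real.exp s • ContinuousLinearMap.id ℝ _)) y := by
    have h1 : HasFDerivAt (fun y : EuclideanSpace ℝ (Fin d) => Real.exp s • (y - x))
        (Real.exp s • ContinuousLinearMap.id ℝ _) y :=
      ((hasFDerivAt_id y).sub_const x).const_smul (Real.exp s)
    exact (((hζ.differentiable (by simp) _).hasFDerivAt).comp y h1).const_mul _
  have hd : ∀ i, fderiv ℝ (fun y : EuclideanSpace ℝ (Fin d) => (y i - x i) * dilate ζ x s y) y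
      (EuclideanSpace.single i 1) = dilate ζ x s y + Real.exp s ^ d * Real.exp s *
        ((y - x) i * fderiv ℝ ζ (Real.exp s • (y - x)) (EuclideanSpace.single i 1)) := by
    intro i
    have h1 : HasFDerivAt (fun y : EuclideanSpace ℝ (Fin d) => y i - x i)
        (EuclideanSpace.proj i : EuclideanSpace ℝ (Fin d) →L[ℝ] ℝ) y :=
      ((EuclideanSpace.proj (𝕜 := ℝ) i).hasFDerivAt (x := y)).sub_const (EuclideanSpace.proj (𝕜 := ℝ) i x)
    have h2 : HasFDerivAt (fun y : EuclideanSpace ℝ (Fin d) => (y i - x i) * dilate ζ x s y) _ y :=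
      h1.mul hk
    rw [h2.fderiv]
    simp
    ring
  have hz : fderiv ℝ ζ (Real.exp s • (y - x)) (y - x) =
      ∑ i, (y - x) i * fderiv ℝ ζ (Real.exp s • (y - x)) (EuclideanSpace.single i 1) := by
    have hb := (EuclideanSpace.basisFun (Fin d) ℝ).sum_repr (y - x)
    calc fderiv ℝ ζ (Real.exp s • (y - x)) (y - x)
        = fderiv ℝ ζ (Real.exp s • (y - x)) (∑ i, (EuclideanSpace.basisFun (Fin d) ℝ).repr (y - x) i •
          EuclideanSpace.basisFun (Fin d) ℝ i) := by rw [hb]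
      _ = _ := by
        rw [map_sum]
        simp only [map_smul]
        simp
  simp_rw [hd]
  rw [Finset.sum_add_distrib, ← Finset.mul_sum, ← hz]
  simp only [Finset.sum_const, Finset.card_univ, Fintype.card_fin, nsmul_eq_mul, dilateDeriv,
    map_smul, smul_eq_mul, dilate]
  ring

/-- `Ω` contains, with uniform inner radius, the cone over a ball from each of its points. -/
def HasUniformCones (Ω : Set (EuclideanSpace ℝ (Fin d))) : Prop :=
  ∃ ρ : ℝ, 0 < ρ ∧ ∀ x ∈ Ω, ∃ p, ∀ z ∈ closedBall p ρ, ∀ t : ℝ, 0 < t → t ≤ 1 →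
    x + t • (z - x) ∈ Ω

variable {Ω : Set (EuclideanSpace ℝ (Fin d))} {u : EuclideanSpace ℝ (Fin d) → ℝ}
  {G : EuclideanSpace ℝ (Fin d) → EuclideanSpace ℝ (Fin d)}

theorem coord_mul_dilate_mem_compactTests (hζ : ContDiff ℝ ∞ ζ) (hζc : HasCompactSupport ζ)
    (hcone : ∀ z ∈ tsupport ζ, ∀ t : ℝ, 0 < t → t ≤ 1 → x + t • z ∈ Ω) {s : ℝ} (hs : 0 ≤ s)
    (i : Fin d) :
    (fun y : EuclideanSpace ℝ (Fin d) => (y i - x i) * dilate ζ x s y) ∈ compactTests Ω := by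
  have hcoord : ContDiff ℝ ∞ (fun y : EuclideanSpace ℝ (Fin d) => y i - x i) :=
    (EuclideanSpace.proj (𝕜 := ℝ) i).contDiff.sub contDiff_const
  have himg : IsCompact ((fun z => x + Real.exp (-s) • z) '' tsupport ζ) :=
    IsCompact.image hζc (by fun_prop)
  have hsub : tsupport (fun y : EuclideanSpace ℝ (Fin d) => (y i - x i) * dilate ζ x s y) ⊆
      (fun z => x + Real.exp (-s) • z) '' tsupport ζ := by
    refine closure_minimal (fun y hy => ?_) himg.isClosed
    have h1 : ζ (Real.exp s • (y - x)) ≠ 0 := right_ne_zero_of_mul (right_ne_zero_of_mul hy)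
    refine ⟨Real.exp s • (y - x), subset_tsupport _ h1, ?_⟩
    simp [smul_smul, ← Real.exp_add]
  refine ⟨hcoord.mul (contDiff_dilate hζ s), himg.of_isClosed_subset (isClosed_tsupport _) hsub,
    hsub.trans ?_⟩
  rintro _ ⟨z, hz, rfl⟩
  exact hcone z hz _ (Real.exp_pos _) (Real.exp_le_one_iff.2 (by linarith))

theorem integral_mul_dilateDeriv (hΩ : Bornology.IsBounded Ω)
    (h : HasWeakGradient (compactTests Ω) Ω u G) (hζ : ContDiff ℝ ∞ ζ) (hζc : HasCompactSupport ζ)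
    (hcone : ∀ z ∈ tsupport ζ, ∀ t : ℝ, 0 < t → t ≤ 1 → x + t • z ∈ Ω) {s : ℝ} (hs : 0 ≤ s) :
    ∫ y in Ω, u y * dilateDeriv ζ x s y = -∫ y in Ω, dilate ζ x s y * ⟪G y, y - x⟫ := by
  have := isFiniteMeasure_restrict_of_isBounded hΩ
  rw [hasWeakGradient_iff (fun φ hφ => hφ.1) hΩ] at h
  obtain ⟨h1, h2, h3⟩ := h
  have hmem := coord_mul_dilate_mem_compactTests hζ hζc hcone hs
  have h1i : Integrable u (volume.restrict Ω) := h1.integrable (by norm_num)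
  have h2i : Integrable G (volume.restrict Ω) := h2.integrable (by norm_num)
  have key : ∀ i, _ := fun i => h3 _ (hmem i) (EuclideanSpace.single i 1)
  have i1 : ∀ i, Integrable (fun y => u y *
      fderiv ℝ (fun y : EuclideanSpace ℝ (Fin d) => (y i - x i) * dilate ζ x s y) y
        (EuclideanSpace.single i 1)) (volume.restrict Ω) := by
    intro i
    have hc : Continuous fun y => fderiv ℝ
        (fun y : EuclideanSpace ℝ (Fin d) => (y i - x i) * dilate ζ x s y) y
        (EuclideanSpace.single i 1) :=
      ((hmem i).1.continuous_fderiv (by simp)).clm_apply continuous_const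
    obtain ⟨C, hC⟩ := ae_restrict_norm_le_of_continuous hΩ hc
    exact h1i.mul_bdd (c := C) hc.aestronglyMeasurable hC
  have i2 : ∀ i : Fin d, Integrable (fun y => (y i - x i) * dilate ζ x s y *
      ⟪G y, EuclideanSpace.single i 1⟫) (volume.restrict Ω) := by
    intro i
    obtain ⟨C, hC⟩ := ae_restrict_norm_le_of_continuous hΩ (hmem i).1.continuous
    exact (h2i.inner_const (𝕜 := ℝ) _).bdd_mul (c := C) (hmem i).1.continuous.aestronglyMeasurable
      hC
  calc ∫ y in Ω, u y * dilateDeriv ζ x s y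
      = ∫ y in Ω, ∑ i, u y *
        fderiv ℝ (fun y : EuclideanSpace ℝ (Fin d) => (y i - x i) * dilate ζ x s y) y
        (EuclideanSpace.single i 1) := by
        simp_rw [← Finset.mul_sum, sum_fderiv_coord_mul_dilate hζ]
    _ = -∑ i, ∫ y in Ω, (y i - x i) * dilate ζ x s y * ⟪G y, EuclideanSpace.single i 1⟫ := by
        rw [integral_finsetSum _ fun i _ => i1 i, ← Finset.sum_neg_distrib]
        exact Finset.sum_congr rfl fun i _ => key i
    _ = -∫ y in Ω, dilate ζ x s y * ⟪G y, y - x⟫ := by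
        rw [← integral_finsetSum _ fun i _ => i2 i]
        congr 2
        ext y
        have : (⟪G y, y - x⟫ : ℝ) = ∑ i, (y i - x i) * ⟪G y, EuclideanSpace.single i 1⟫ := by
          rw [PiLp.inner_apply]
          refine Finset.sum_congr rfl fun i _ => ?_
          rw [EuclideanSpace.inner_single_right]
          simp
        rw [this, Finset.mul_sum]
        refine Finset.sum_congr rfl fun i _ => ?_
        ring

/-- The change of a mean of `u` under dilation is controlled by the weak gradient. -/
theorem enorm_integral_dilate_sub_le (hΩ : Bornology.IsBounded Ω)
    (h : HasWeakGradient (compactTests Ω) Ω u G) (hζ : ContDiff ℝ ∞ ζ) (hζc : HasCompactSupport ζ)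
    (hcone : ∀ z ∈ tsupport ζ, ∀ t : ℝ, 0 < t → t ≤ 1 → x + t • z ∈ Ω) {S : ℝ} (hS : 0 ≤ S) :
    ‖(∫ y in Ω, u y * dilate ζ x S y) - ∫ y in Ω, u y * dilate ζ x 0 y‖ₑ ≤
      ∫⁻ y in Ω, ‖G y‖ₑ * (‖x - y‖ₑ * ∫⁻ s in Set.Ioc 0 S, ‖dilate ζ x s y‖ₑ) := by
  have := isFiniteMeasure_restrict_of_isBounded hΩ
  have h1i : Integrable u (volume.restrict Ω) := h.memLp.integrable (by norm_num)
  have hcont := continuous_dilateDeriv (x := x) hζ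
  have hint : Integrable (Function.uncurry fun y s => u y * dilateDeriv ζ x s y)
      ((volume.restrict Ω).prod (volume.restrict (Set.Ioc 0 S))) := by
    obtain ⟨C, hC⟩ := (hΩ.isCompact_closure.prod (isCompact_Icc (a := 0)
      (b := S))).exists_bound_of_continuousOn hcont.continuousOn
    refine Integrable.mul_bdd (c := C) (h1i.comp_fst _) hcont.aestronglyMeasurable ?_
    rw [Measure.prod_restrict]
    refine ae_mono (Measure.restrict_mono (Set.prod_mono subset_closure Set.Ioc_subset_Icc_self)
      le_rfl) (ae_restrict_of_forall_mem ?_ hC)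
    exact (isClosed_closure.prod isClosed_Icc).measurableSet
  have iu : ∀ s, Integrable (fun y => u y * dilate ζ x s y) (volume.restrict Ω) := by
    intro s
    have hc := (contDiff_dilate (x := x) hζ s).continuous
    obtain ⟨C, hC⟩ := ae_restrict_norm_le_of_continuous hΩ hc
    exact h1i.mul_bdd (c := C) hc.aestronglyMeasurable hC
  have e1 : (∫ y in Ω, u y * dilate ζ x S y) - ∫ y in Ω, u y * dilate ζ x 0 y =
      ∫ y in Ω, ∫ s in Set.Ioc 0 S, u y * dilateDeriv ζ x s y := by
    rw [← integral_sub (iu S) (iu 0)]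
    congr 1
    ext y
    have hcy : Continuous fun s => dilateDeriv ζ x s y :=
      hcont.comp (continuous_const.prodMk continuous_id)
    rw [integral_const_mul, ← intervalIntegral.integral_of_le hS,
      intervalIntegral.integral_eq_sub_of_hasDerivAt (fun s _ => hasDerivAt_dilate hζ y s)
        (hcy.intervalIntegrable _ _), mul_sub]
  rw [e1, integral_integral_swap hint]
  have hG : AEMeasurable G (volume.restrict Ω) := h.memLp_grad.aestronglyMeasurable.aemeasurable
  have hm : AEMeasurable (Function.uncurry fun s y => ‖G y‖ₑ * (‖x - y‖ₑ * ‖dilate ζ x s y‖ₑ))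
      ((volume.restrict (Set.Ioc 0 S)).prod (volume.restrict Ω)) := by
    have m1 : Continuous fun p : ℝ × EuclideanSpace ℝ (Fin d) => dilate ζ x p.1 p.2 :=
      (continuous_dilate (x := x) hζ.continuous).comp continuous_swap
    have m2 : Continuous fun p : ℝ × EuclideanSpace ℝ (Fin d) => x - p.2 := by fun_prop
    exact (hG.comp_snd.enorm).mul
      ((m2.enorm.measurable.aemeasurable).mul m1.enorm.measurable.aemeasurable)
  calc ‖∫ s in Set.Ioc 0 S, ∫ y in Ω, u y * dilateDeriv ζ x s y‖ₑ
      ≤ ∫⁻ s in Set.Ioc 0 S, ‖∫ y in Ω, u y * dilateDeriv ζ x s y‖ₑ :=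
        enorm_integral_le_lintegral_enorm _
    _ ≤ ∫⁻ s in Set.Ioc 0 S, ∫⁻ y in Ω, ‖G y‖ₑ * (‖x - y‖ₑ * ‖dilate ζ x s y‖ₑ) := by
        refine setLIntegral_mono_ae' measurableSet_Ioc (Eventually.of_forall fun s hs => ?_)
        rw [integral_mul_dilateDeriv hΩ h hζ hζc hcone hs.1.le, enorm_neg]
        refine (enorm_integral_le_lintegral_enorm _).trans (lintegral_mono fun y => ?_)
        dsimp only
        rw [enorm_mul, mul_comm, ← mul_assoc]
        gcongr
        rw [← ofReal_norm, ← ofReal_norm, ← ofReal_norm, ← ENNReal.ofReal_mul (norm_nonneg _)]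
        apply ENNReal.ofReal_le_ofReal
        rw [norm_sub_rev x y]
        exact norm_inner_le_norm _ _
    _ = ∫⁻ y in Ω, ∫⁻ s in Set.Ioc 0 S, ‖G y‖ₑ * (‖x - y‖ₑ * ‖dilate ζ x s y‖ₑ) :=
        lintegral_lintegral_swap hm
    _ = ∫⁻ y in Ω, ‖G y‖ₑ * (‖x - y‖ₑ * ∫⁻ s in Set.Ioc 0 S, ‖dilate ζ x s y‖ₑ) := by
        refine lintegral_congr fun y => ?_
        rw [lintegral_const_mul' _ _ enorm_ne_top, lintegral_const_mul' _ _ enorm_ne_top]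

/-- The dilations integrate over the dilation parameter to a multiple of `|x - y|⁻ᵈ`. -/
theorem setLIntegral_enorm_dilate_le (hd : 0 < d) {M D : ℝ} (hM : ∀ z, |ζ z| ≤ M)
    (hD : ∀ z, ζ z ≠ 0 → ‖z‖ ≤ D) {y : EuclideanSpace ℝ (Fin d)} (hxy : x ≠ y) (hD0 : 0 < D)
    (S : ℝ) :
    ∫⁻ s in Set.Ioc 0 S, ‖dilate ζ x s y‖ₑ ≤
      ENNReal.ofReal (M * D ^ d) * (‖x - y‖ₑ ^ d)⁻¹ := by
  have hM0 : 0 ≤ M := (abs_nonneg _).trans (hM 0)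
  have hr : 0 < ‖x - y‖ := norm_pos_iff.2 (sub_ne_zero.2 hxy)
  set c := Real.log (D / ‖x - y‖)
  have hd' : (0 : ℝ) < d := by exact_mod_cast hd
  have hpt : ∀ s, ‖dilate ζ x s y‖ₑ ≤
      (Set.Iic c).indicator (fun s => ENNReal.ofReal (M * Real.exp (d * s))) s := by
    intro s
    by_cases hz : ζ (Real.exp s • (y - x)) = 0
    · simp [dilate, hz]
    · have h1 := hD _ hz
      rw [norm_smul, Real.norm_of_nonneg (Real.exp_pos s).le, norm_sub_rev] at h1
      have h2 : s ≤ c := by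
        rw [Real.le_log_iff_exp_le (by positivity), le_div_iff₀ hr]
        exact h1
      rw [Set.indicator_of_mem (show s ∈ Set.Iic c from h2), ← ofReal_norm]
      apply ENNReal.ofReal_le_ofReal
      rw [dilate, norm_mul, Real.norm_of_nonneg (by positivity), mul_comm, Real.exp_nat_mul]
      exact mul_le_mul_of_nonneg_right (hM _) (by positivity)
  calc ∫⁻ s in Set.Ioc 0 S, ‖dilate ζ x s y‖ₑ
      ≤ ∫⁻ s, (Set.Iic c).indicator (fun s => ENNReal.ofReal (M * Real.exp (d * s))) s :=
        (setLIntegral_le_lintegral _ _).trans (lintegral_mono hpt)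
    _ = ENNReal.ofReal (M * (Real.exp (d * c) / d)) := by
        rw [lintegral_indicator measurableSet_Iic, ← ofReal_integral_eq_lintegral_ofReal,
          integral_const_mul, integral_exp_mul_Iic hd']
        · exact (integrableOn_exp_mul_Iic hd' c).const_mul M
        · exact Eventually.of_forall fun s => by positivity
    _ ≤ ENNReal.ofReal (M * D ^ d * (‖x - y‖ ^ d)⁻¹) := by
        apply ENNReal.ofReal_le_ofReal
        have : Real.exp (d * c) = D ^ d * (‖x - y‖ ^ d)⁻¹ := by
          rw [Real.exp_nat_mul, Real.exp_log (by positivity), div_pow, div_eq_mul_inv]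
        rw [this, mul_assoc]
        gcongr
        refine div_le_self (by positivity) ?_
        exact_mod_cast hd
    _ = ENNReal.ofReal (M * D ^ d) * (‖x - y‖ₑ ^ d)⁻¹ := by
        rw [ENNReal.ofReal_mul (by positivity), ENNReal.ofReal_inv_of_pos (by positivity),
          ENNReal.ofReal_pow (norm_nonneg _), ofReal_norm]

/-- At a Lebesgue point the means over ever smaller dilations converge to the value. -/
theorem tendsto_integral_dilate (hΩ : MeasurableSet Ω) (hu : IntegrableOn u Ω)
    {M D : ℝ} (hD0 : 0 < D) (hx : x ∈ Ω)
    (hleb : Tendsto (fun r => ⨍ y in closedBall x r, ‖Ω.indicator u y - Ω.indicator u x‖)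
      (𝓝[>] 0) (𝓝 0))
    (hζ1 : ∫ z, ζ z = 1) (hM : ∀ z, |ζ z| ≤ M) (hD : ∀ z, ζ z ≠ 0 → ‖z‖ ≤ D) :
    Tendsto (fun n : ℕ => ∫ y in Ω, u y * dilate ζ x n y) atTop (𝓝 (u x)) := by
  have hr : Tendsto (fun n : ℕ => D * Real.exp (-(n : ℝ))) atTop (𝓝[>] 0) := by
    refine tendsto_nhdsWithin_iff.2 ⟨?_, Eventually.of_forall fun n => ?_⟩
    · have := (Real.tendsto_exp_neg_atTop_nhds_zero.comp
        (tendsto_natCast_atTop_atTop (R := ℝ))).const_mul D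
      simpa using this
    · exact mul_pos hD0 (Real.exp_pos _)
  have hui : Integrable (Ω.indicator u) := (integrable_indicator_iff hΩ).2 hu
  have key := tendsto_integral_smul_of_tendsto_average_norm_sub
    (g := fun (n : ℕ) y => dilate ζ x n y)
    (M * (D ^ d * volume.real (closedBall (0 : EuclideanSpace ℝ (Fin d)) 1)))
    (hleb.comp hr) (Eventually.of_forall fun n => hui.integrableOn) ?_ ?_ ?_
  · rw [Set.indicator_of_mem hx] at key
    refine key.congr fun n => ?_
    rw [← integral_indicator hΩ]
    congr 1
    ext y
    by_cases hy : y ∈ Ω <;> simp [hy, mul_comm]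
  · refine tendsto_const_nhds.congr fun n => ?_
    simp only [dilate]
    rw [integral_const_mul, integral_sub_right_eq_self (fun y => ζ (Real.exp n • y)) x,
      Measure.integral_comp_smul, hζ1, finrank_euclideanSpace, Fintype.card_fin,
      abs_of_pos (by positivity), smul_eq_mul, mul_one, mul_inv_cancel₀ (by positivity)]
  · refine Eventually.of_forall fun n y hy => ?_
    have h1 := hD _ (right_ne_zero_of_mul hy)
    rw [norm_smul, Real.norm_of_nonneg (Real.exp_pos _).le] at h1
    rw [mem_closedBall, dist_eq_norm, Real.exp_neg, ← div_eq_mul_inv,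
      le_div_iff₀ (Real.exp_pos _), mul_comm]
    exact h1
  · refine Eventually.of_forall fun n y => ?_
    rw [Measure.addHaar_real_closedBall' _ x (mul_pos hD0 (Real.exp_pos _)).le,
      finrank_euclideanSpace, Fintype.card_fin, mul_pow]
    have hv : 0 < volume.real (closedBall (0 : EuclideanSpace ℝ (Fin d)) 1) :=
      ENNReal.toReal_pos (measure_closedBall_pos _ _ one_pos).ne' measure_closedBall_lt_top.ne
    have e : M * (D ^ d * volume.real (closedBall (0 : EuclideanSpace ℝ (Fin d)) 1)) /
        (D ^ d * Real.exp (-(n : ℝ)) ^ d *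
          volume.real (closedBall (0 : EuclideanSpace ℝ (Fin d)) 1)) = Real.exp n ^ d * M := by
      rw [Real.exp_neg, inv_pow]
      field_simp
    rw [e, dilate, abs_mul, abs_of_pos (by positivity)]
    gcongr
    exact hM _

/-- A Sobolev function is controlled, almost everywhere, by the Riesz potential of the function and
its gradient. -/
theorem exists_enorm_le_riesz_potential (hd : 0 < d) (hΩo : IsOpen Ω)
    (hΩ : Bornology.IsBounded Ω) (hcone : HasUniformCones Ω) :
    ∃ C : ℝ, 0 ≤ C ∧ ∀ u G, HasWeakGradient (compactTests Ω) Ω u G →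
      ∀ᵐ x ∂volume.restrict Ω, ‖u x‖ₑ ≤
        ENNReal.ofReal C * ∫⁻ y in Ω, (‖u y‖ₑ + ‖G y‖ₑ) * (‖x - y‖ₑ ^ (d - 1))⁻¹ := by
  obtain ⟨ρ, hρ, hcone⟩ := hcone
  obtain ⟨R, hR0, hR⟩ := hΩ.exists_pos_norm_le
  let bump : ContDiffBump (0 : EuclideanSpace ℝ (Fin d)) := ⟨ρ / 2, ρ, by positivity, by linarith⟩
  set η := bump.normed volume
  have hηs : ContDiff ℝ ∞ η := bump.contDiff_normed
  have hηc : HasCompactSupport η := bump.hasCompactSupport_normed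
  obtain ⟨M, hM⟩ := hηc.exists_bound_of_continuous hηs.continuous
  have hM0 : 0 ≤ M := (norm_nonneg _).trans (hM 0)
  set D : ℝ := 2 * R
  refine ⟨M * D ^ (d - 1) + M * D ^ d, by positivity, fun u G h => ?_⟩
  have := isFiniteMeasure_restrict_of_isBounded hΩ
  have hui : IntegrableOn u Ω := h.memLp.integrable (by norm_num)
  have hdist : ∀ x ∈ Ω, ∀ y ∈ Ω, ‖x - y‖ ≤ D := fun x hx y hy =>
    (norm_sub_le _ _).trans (by linarith [hR x hx, hR y hy])
  have hleb := (Besicovitch.vitaliFamily (volume : Measure (EuclideanSpace ℝ (Fin d)))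
    ).ae_tendsto_average_norm_sub
    ((integrable_indicator_iff hΩo.measurableSet).2 hui).locallyIntegrable
  rw [ae_restrict_iff' hΩo.measurableSet]
  filter_upwards [hleb] with x hlx hx
  replace hlx := hlx.comp (Besicovitch.tendsto_filterAt volume x)
  obtain ⟨p, hp⟩ := hcone x hx
  set ζ : EuclideanSpace ℝ (Fin d) → ℝ := fun z => η (z - (p - x))
  have hζ : ContDiff ℝ ∞ ζ := hηs.comp (contDiff_id.sub contDiff_const)
  have hζsub : tsupport ζ ⊆ closedBall (p - x) ρ := by
    refine closure_minimal (fun z hz => ?_) isClosed_closedBall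
    have : z - (p - x) ∈ Function.support η := hz
    rw [bump.support_normed_eq, mem_ball_zero_iff] at this
    rw [mem_closedBall, dist_eq_norm]
    exact this.le
  have hζc : HasCompactSupport ζ :=
    (isCompact_closedBall _ _).of_isClosed_subset (isClosed_tsupport _) hζsub
  have hζcone : ∀ z ∈ tsupport ζ, ∀ t : ℝ, 0 < t → t ≤ 1 → x + t • z ∈ Ω := by
    intro z hz t h0 h1
    have := hp (x + z) ?_ t h0 h1
    · rwa [add_sub_cancel_left] at this
    · have := hζsub hz
      rw [mem_closedBall, dist_eq_norm] at this ⊢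
      rwa [show x + z - p = z - (p - x) by abel]
  have hζM : ∀ z, |ζ z| ≤ M := fun z => hM _
  have hζD : ∀ z, ζ z ≠ 0 → ‖z‖ ≤ D := by
    intro z hz
    have h1 := hζcone z (subset_tsupport _ hz) 1 one_pos le_rfl
    have := hdist _ h1 x hx
    simpa using this
  have hζ1 : ∫ z, ζ z = 1 := by
    rw [integral_sub_right_eq_self η (p - x)]
    exact bump.integral_normed
  have hlim := tendsto_integral_dilate (u := u) hΩo.measurableSet hui (by positivity) hx hlx hζ1
    hζM hζD
  have hker : ∀ y ∈ Ω, x ≠ y → ∀ S, ‖x - y‖ₑ * ∫⁻ s in Set.Ioc 0 S, ‖dilate ζ x s y‖ₑ ≤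
      ENNReal.ofReal (M * D ^ d) * (‖x - y‖ₑ ^ (d - 1))⁻¹ := by
    intro y hy hxy S
    have hpos : ‖x - y‖ₑ ≠ 0 := by simpa [sub_eq_zero] using hxy
    calc ‖x - y‖ₑ * ∫⁻ s in Set.Ioc 0 S, ‖dilate ζ x s y‖ₑ
        ≤ ‖x - y‖ₑ * (ENNReal.ofReal (M * D ^ d) * (‖x - y‖ₑ ^ d)⁻¹) := by
          gcongr
          exact setLIntegral_enorm_dilate_le hd hζM hζD hxy (by positivity) S
      _ = ENNReal.ofReal (M * D ^ d) * (‖x - y‖ₑ * (‖x - y‖ₑ ^ (d - 1 + 1))⁻¹) := by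
          rw [Nat.sub_add_cancel hd]; ring
      _ = ENNReal.ofReal (M * D ^ d) * (‖x - y‖ₑ ^ (d - 1))⁻¹ := by
          rw [pow_succ, ENNReal.mul_inv (Or.inr enorm_ne_top) (Or.inr hpos), mul_comm (_ ^ _)⁻¹,
            ← mul_assoc ‖x - y‖ₑ, ENNReal.mul_inv_cancel hpos enorm_ne_top, one_mul]
  have hne : ∀ᵐ y ∂volume.restrict Ω, x ≠ y := by
    have : Nonempty (Fin d) := ⟨⟨0, hd⟩⟩
    refine ae_restrict_of_ae ?_
    have := (volume : Measure (EuclideanSpace ℝ (Fin d))).ae_ne x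
    filter_upwards [this] with y hy using hy.symm
  have hmem : ∀ᵐ y ∂volume.restrict Ω, y ∈ Ω := ae_restrict_mem hΩo.measurableSet
  have hG : AEMeasurable G (volume.restrict Ω) := h.memLp_grad.aestronglyMeasurable.aemeasurable
  have hum : AEMeasurable u (volume.restrict Ω) := h.memLp.aestronglyMeasurable.aemeasurable
  have hκm : Measurable fun y => (‖x - y‖ₑ ^ (d - 1))⁻¹ := by fun_prop
  set P := ∫⁻ y in Ω, ‖u y‖ₑ * (‖x - y‖ₑ ^ (d - 1))⁻¹
  set Q := ∫⁻ y in Ω, ‖G y‖ₑ * (‖x - y‖ₑ ^ (d - 1))⁻¹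
  have hmean : ‖∫ y in Ω, u y * dilate ζ x 0 y‖ₑ ≤ ENNReal.ofReal (M * D ^ (d - 1)) * P := by
    refine (enorm_integral_le_lintegral_enorm _).trans ?_
    rw [← lintegral_const_mul' _ _ ENNReal.ofReal_ne_top]
    refine lintegral_mono_ae ?_
    filter_upwards [hne, hmem] with y hxy hy
    have hpos : 0 < ‖x - y‖ := norm_pos_iff.2 (sub_ne_zero.2 hxy)
    rw [enorm_mul, mul_left_comm]
    gcongr
    rw [← ofReal_norm, ← ofReal_norm (x - y), ← ENNReal.ofReal_pow (norm_nonneg _),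
      ← ENNReal.ofReal_inv_of_pos (by positivity), ← ENNReal.ofReal_mul (by positivity)]
    apply ENNReal.ofReal_le_ofReal
    have h1 : ‖dilate ζ x 0 y‖ ≤ M := by simpa [dilate] using hζM _
    refine h1.trans ?_
    rw [mul_assoc]
    refine le_mul_of_one_le_right hM0 ?_
    rw [← div_eq_mul_inv, one_le_div (by positivity)]
    exact pow_le_pow_left₀ hpos.le (hdist x hx y hy) _
  have hdiff : ∀ n : ℕ, ‖(∫ y in Ω, u y * dilate ζ x n y) - ∫ y in Ω, u y * dilate ζ x 0 y‖ₑ ≤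
      ENNReal.ofReal (M * D ^ d) * Q := by
    intro n
    refine (enorm_integral_dilate_sub_le hΩ h hζ hζc hζcone (Nat.cast_nonneg n)).trans ?_
    rw [← lintegral_const_mul' _ _ ENNReal.ofReal_ne_top]
    refine lintegral_mono_ae ?_
    filter_upwards [hne, hmem] with y hxy hy
    calc ‖G y‖ₑ * (‖x - y‖ₑ * ∫⁻ s in Set.Ioc 0 (n : ℝ), ‖dilate ζ x s y‖ₑ)
        ≤ ‖G y‖ₑ * (ENNReal.ofReal (M * D ^ d) * (‖x - y‖ₑ ^ (d - 1))⁻¹) :=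
          mul_le_mul_right (hker y hy hxy n) _
      _ = _ := mul_left_comm _ _ _
  have hbound : ∀ n : ℕ, ‖∫ y in Ω, u y * dilate ζ x n y‖ₑ ≤
      ENNReal.ofReal (M * D ^ (d - 1)) * P + ENNReal.ofReal (M * D ^ d) * Q := by
    intro n
    have := enorm_add_le (∫ y in Ω, u y * dilate ζ x 0 y)
      ((∫ y in Ω, u y * dilate ζ x n y) - ∫ y in Ω, u y * dilate ζ x 0 y)
    rw [add_sub_cancel] at this
    exact this.trans (add_le_add hmean (hdiff n))
  refine (le_of_tendsto hlim.enorm (Eventually.of_forall hbound)).trans ?_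
  have hsplit : ∫⁻ y in Ω, (‖u y‖ₑ + ‖G y‖ₑ) * (‖x - y‖ₑ ^ (d - 1))⁻¹ = P + Q := by
    simp_rw [add_mul]
    exact lintegral_add_left' (hum.enorm.mul hκm.aemeasurable) _
  rw [hsplit, ENNReal.ofReal_add (by positivity) (by positivity), add_mul]
  gcongr
  · exact le_self_add
  · exact le_add_self

end Representation

/-! ### The Riesz kernel -/

section Kernel

open Filter Topology Metric

variable {d : ℕ}

theorem setLIntegral_ball_riesz_kernel_le (hd : 0 < d) {ρ : ℝ} (hρ : 0 ≤ ρ)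
    (x : EuclideanSpace ℝ (Fin d)) :
    ∫⁻ y in ball x ρ, (‖x - y‖ₑ ^ (d - 1))⁻¹ ≤
      ENNReal.ofReal (d * volume.real (ball (0 : EuclideanSpace ℝ (Fin d)) 1) * ρ) := by
  have : Nonempty (Fin d) := ⟨⟨0, hd⟩⟩
  set f : ℝ → ℝ := (Set.Iio ρ).indicator fun r => (r ^ (d - 1))⁻¹
  have hcongr : Set.EqOn (fun y : ℝ => y ^ (d - 1) • f y)
      ((Set.Iio ρ).indicator fun _ => (1 : ℝ)) (Set.Ioi 0) := by
    intro y hy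
    have hy' : (0 : ℝ) < y := hy
    by_cases h : y < ρ
    · simp [f, h, hy'.ne']
    · simp [f, h]
  have hint : Integrable (fun y : EuclideanSpace ℝ (Fin d) => f ‖y‖) := by
    rw [integrable_fun_norm_addHaar, finrank_euclideanSpace, Fintype.card_fin,
      integrableOn_congr_fun hcongr measurableSet_Ioi, IntegrableOn,
      integrable_indicator_iff measurableSet_Iio, IntegrableOn,
      Measure.restrict_restrict measurableSet_Iio]
    refine integrableOn_const (hs := ?_)
    rw [Set.inter_comm, Set.Ioi_inter_Iio]
    exact measure_Ioo_lt_top.ne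
  have hval : ∫ y : EuclideanSpace ℝ (Fin d), f ‖y‖ =
      d * volume.real (ball (0 : EuclideanSpace ℝ (Fin d)) 1) * ρ := by
    rw [integral_fun_norm_addHaar, finrank_euclideanSpace, Fintype.card_fin,
      setIntegral_congr_fun measurableSet_Ioi hcongr, setIntegral_indicator measurableSet_Iio,
      Set.Ioi_inter_Iio]
    simp [hρ, mul_assoc]
  calc ∫⁻ y in ball x ρ, (‖x - y‖ₑ ^ (d - 1))⁻¹
      = ∫⁻ y, (ball (0 : EuclideanSpace ℝ (Fin d)) ρ).indicator
          (fun z => (‖z‖ₑ ^ (d - 1))⁻¹) (x - y) := by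
        rw [← lintegral_indicator measurableSet_ball]
        refine lintegral_congr fun y => ?_
        by_cases h : y ∈ ball x ρ
        · have h' : x - y ∈ ball (0 : EuclideanSpace ℝ (Fin d)) ρ := by
            rwa [mem_ball_zero_iff, ← dist_eq_norm, dist_comm]
          rw [Set.indicator_of_mem h, Set.indicator_of_mem h']
        · have h' : x - y ∉ ball (0 : EuclideanSpace ℝ (Fin d)) ρ := by
            rwa [mem_ball_zero_iff, ← dist_eq_norm, dist_comm]
          rw [Set.indicator_of_notMem h, Set.indicator_of_notMem h']
    _ = ∫⁻ z, (ball (0 : EuclideanSpace ℝ (Fin d)) ρ).indicator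
          (fun z => (‖z‖ₑ ^ (d - 1))⁻¹) z := lintegral_sub_left_eq_self _ x
    _ = ∫⁻ z, ENNReal.ofReal (f ‖z‖) := by
        refine lintegral_congr_ae ?_
        filter_upwards [(volume : Measure (EuclideanSpace ℝ (Fin d))).ae_ne 0] with z hz
        have hz' : 0 < ‖z‖ := norm_pos_iff.2 hz
        by_cases h : ‖z‖ < ρ
        · rw [Set.indicator_of_mem (by simpa using h)]
          simp only [f]
          rw [Set.indicator_of_mem (by simpa using h), ENNReal.ofReal_inv_of_pos (by positivity),
            ENNReal.ofReal_pow hz'.le, ofReal_norm]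
        · rw [Set.indicator_of_notMem (by simpa using h)]
          simp only [f]
          rw [Set.indicator_of_notMem (by simpa using h), ENNReal.ofReal_zero]
    _ = ENNReal.ofReal (∫ y : EuclideanSpace ℝ (Fin d), f ‖y‖) := by
        rw [ofReal_integral_eq_lintegral_ofReal hint]
        refine Eventually.of_forall fun z => ?_
        exact Set.indicator_apply_nonneg fun _ => by positivity
    _ ≤ _ := by rw [hval]

/-- In dimensions two and three the Riesz kernel integrates over a set of measure at most `b³` to
at most a multiple of `b`. -/
theorem exists_setLIntegral_riesz_kernel_le (hd : d = 2 ∨ d = 3) (v : ℝ) :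
    ∃ c : ℝ, 0 ≤ c ∧ ∀ (A : Set (EuclideanSpace ℝ (Fin d))) (b : ℝ), 0 < b → b ≤ v →
      volume A ≤ ENNReal.ofReal (b ^ 3) → ∀ x,
        ∫⁻ y in A, (‖x - y‖ₑ ^ (d - 1))⁻¹ ≤ ENNReal.ofReal (c * b) := by
  set c₀ := d * volume.real (ball (0 : EuclideanSpace ℝ (Fin d)) 1)
  have hc₀ : 0 ≤ c₀ := by positivity
  refine ⟨c₀ + (1 + |v|), by positivity, fun A b hb hbv hA x => ?_⟩
  have h1 : ∫⁻ y in A ∩ ball x b, (‖x - y‖ₑ ^ (d - 1))⁻¹ ≤ ENNReal.ofReal (c₀ * b) :=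
    (lintegral_mono_set Set.inter_subset_right).trans
      (setLIntegral_ball_riesz_kernel_le (by omega) hb.le x)
  have h2 : ∫⁻ y in A \ ball x b, (‖x - y‖ₑ ^ (d - 1))⁻¹ ≤ ENNReal.ofReal ((1 + |v|) * b) := by
    calc ∫⁻ y in A \ ball x b, (‖x - y‖ₑ ^ (d - 1))⁻¹
        ≤ ∫⁻ y in (ball x b)ᶜ ∩ A, (‖x - y‖ₑ ^ (d - 1))⁻¹ := by
          rw [Set.sdiff_eq, Set.inter_comm]
      _ = ∫⁻ y in (ball x b)ᶜ, (‖x - y‖ₑ ^ (d - 1))⁻¹ ∂volume.restrict A := by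
          rw [Measure.restrict_restrict measurableSet_ball.compl]
      _ ≤ ∫⁻ y in (ball x b)ᶜ, ENNReal.ofReal ((b ^ (d - 1))⁻¹) ∂volume.restrict A := by
          refine setLIntegral_mono measurable_const fun y hy => ?_
          have hy' : b ≤ ‖x - y‖ := by
            rw [Set.mem_compl_iff, mem_ball, not_lt, dist_comm, dist_eq_norm] at hy
            exact hy
          rw [ENNReal.ofReal_inv_of_pos (by positivity), ENNReal.inv_le_inv,
            ENNReal.ofReal_pow hb.le, ← ofReal_norm]
          gcongr
      _ ≤ ∫⁻ y in A, ENNReal.ofReal ((b ^ (d - 1))⁻¹) := setLIntegral_le_lintegral _ _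
      _ = ENNReal.ofReal ((b ^ (d - 1))⁻¹) * volume A := by simp
      _ ≤ ENNReal.ofReal ((b ^ (d - 1))⁻¹) * ENNReal.ofReal (b ^ 3) := by gcongr
      _ ≤ ENNReal.ofReal ((1 + |v|) * b) := by
          rw [← ENNReal.ofReal_mul (by positivity)]
          apply ENNReal.ofReal_le_ofReal
          have hv : b ≤ |v| := hbv.trans (le_abs_self v)
          rcases hd with rfl | rfl
          · have : (b ^ (2 - 1))⁻¹ * b ^ 3 = b * b := by
              simp only [Nat.add_one_sub_one, pow_one]
              field_simp
            rw [this]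
            gcongr
            linarith
          · have : (b ^ (3 - 1))⁻¹ * b ^ 3 = b := by
              simp only [Nat.add_one_sub_one]
              field_simp
            rw [this]
            nlinarith [abs_nonneg v]
  calc ∫⁻ y in A, (‖x - y‖ₑ ^ (d - 1))⁻¹
      = (∫⁻ y in A ∩ ball x b, (‖x - y‖ₑ ^ (d - 1))⁻¹) +
          ∫⁻ y in A \ ball x b, (‖x - y‖ₑ ^ (d - 1))⁻¹ :=
        (lintegral_inter_add_sdiff _ _ measurableSet_ball).symm
    _ ≤ _ := add_le_add h1 h2
    _ = _ := by
      rw [← ENNReal.ofReal_add (by positivity) (by positivity), ← add_mul]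

variable {α : Type*} [MeasurableSpace α] {μ : Measure α}

/-- The Cauchy–Schwarz inequality for nonnegative functions. -/
theorem sq_lintegral_mul_le {f g : α → ℝ≥0∞} (hf : AEMeasurable f μ) (hg : AEMeasurable g μ) :
    (∫⁻ a, f a * g a ∂μ) ^ 2 ≤ (∫⁻ a, f a ^ 2 ∂μ) * ∫⁻ a, g a ^ 2 ∂μ := by
  have h := ENNReal.lintegral_mul_le_Lp_mul_Lq μ Real.HolderConjugate.two_two hf hg
  simp only [Pi.mul_apply, ENNReal.rpow_two] at h
  calc (∫⁻ a, f a * g a ∂μ) ^ 2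
      ≤ ((∫⁻ a, f a ^ 2 ∂μ) ^ (1 / 2 : ℝ) * (∫⁻ a, g a ^ 2 ∂μ) ^ (1 / 2 : ℝ)) ^ 2 := by gcongr
    _ = _ := by
      rw [mul_pow, ← ENNReal.rpow_two, ← ENNReal.rpow_two, ← ENNReal.rpow_mul,
        ← ENNReal.rpow_mul]
      norm_num

/-- Schur's test in `L²` for a symmetric kernel. -/
theorem lintegral_sq_lintegral_kernel_le [SFinite μ] {κ : α → α → ℝ≥0∞}
    (hκ : Measurable (Function.uncurry κ)) (hsymm : ∀ x y, κ x y = κ y x) {B : ℝ≥0∞}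
    (hB : ∀ x, ∫⁻ y, κ x y ∂μ ≤ B) {f : α → ℝ≥0∞} (hf : AEMeasurable f μ) :
    ∫⁻ x, (∫⁻ y, f y * κ x y ∂μ) ^ 2 ∂μ ≤ B ^ 2 * ∫⁻ y, f y ^ 2 ∂μ := by
  have hκx : ∀ x, Measurable (κ x) := fun x => hκ.comp measurable_prodMk_left
  have hpt : ∀ x, (∫⁻ y, f y * κ x y ∂μ) ^ 2 ≤ (∫⁻ y, f y ^ 2 * κ x y ∂μ) * B := by
    intro x
    have hsq : ∀ y, (κ x y ^ (1 / 2 : ℝ)) ^ 2 = κ x y := fun y => by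
      rw [← ENNReal.rpow_two, ← ENNReal.rpow_mul]
      norm_num
    have hm : AEMeasurable (fun y => κ x y ^ (1 / 2 : ℝ)) μ :=
      ((hκx x).pow_const _).aemeasurable
    have := sq_lintegral_mul_le (hf.mul hm) hm
    simp only [Pi.mul_apply, mul_pow, hsq, mul_assoc, ← sq] at this
    exact this.trans (by gcongr; exact hB x)
  calc ∫⁻ x, (∫⁻ y, f y * κ x y ∂μ) ^ 2 ∂μ
      ≤ ∫⁻ x, B * ∫⁻ y, f y ^ 2 * κ x y ∂μ ∂μ :=
        lintegral_mono fun x => (hpt x).trans_eq (mul_comm _ _)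
    _ = B * ∫⁻ x, ∫⁻ y, f y ^ 2 * κ x y ∂μ ∂μ := by
        rw [lintegral_const_mul'']
        exact AEMeasurable.lintegral_prod_right' (f := fun p : α × α => f p.2 ^ 2 * κ p.1 p.2)
          (((hf.pow_const 2).comp_snd).mul hκ.aemeasurable)
    _ = B * ∫⁻ y, ∫⁻ x, f y ^ 2 * κ x y ∂μ ∂μ := by
        rw [lintegral_lintegral_swap]
        exact ((hf.pow_const 2).comp_snd).mul hκ.aemeasurable
    _ ≤ B * ∫⁻ y, f y ^ 2 * B ∂μ := by
        gcongr with y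
        have : ∀ x, κ x y = κ y x := fun x => hsymm x y
        simp_rw [this]
        rw [lintegral_const_mul _ (hκx y)]
        gcongr
        exact hB y
    _ = B ^ 2 * ∫⁻ y, f y ^ 2 ∂μ := by
        rw [lintegral_mul_const'' _ (hf.pow_const 2)]
        ring

end Kernel

/-! ### Truncation -/

section Truncation

/-- A `C¹` truncation: it vanishes below `k` and has slope one above `k + δ`. -/
noncomputable def trunc (k δ t : ℝ) : ℝ :=
  ((max 0 (t - k)) ^ 2 - (max 0 (t - k - δ)) ^ 2) / (2 * δ)

/-- The derivative of `trunc k δ`. -/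
noncomputable def truncSlope (k δ t : ℝ) : ℝ :=
  (max 0 (t - k) - max 0 (t - k - δ)) / δ

theorem hasDerivAt_sq_max_zero (t : ℝ) :
    HasDerivAt (fun s : ℝ => (max 0 s) ^ 2) (2 * max 0 t) t := by
  rcases lt_trichotomy t 0 with ht | rfl | ht
  · rw [max_eq_left ht.le, mul_zero]
    refine (hasDerivAt_const t (0 : ℝ)).congr_of_eventuallyEq ?_
    filter_upwards [gt_mem_nhds ht] with s hs
    rw [max_eq_left hs.le]
    norm_num
  · rw [hasDerivAt_iff_isLittleO]
    simp only [max_self, mul_zero, smul_zero, sub_zero, ne_eq, OfNat.ofNat_ne_zero,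
      not_false_eq_true, zero_pow]
    refine Asymptotics.IsBigO.trans_isLittleO (g := fun s : ℝ => s ^ 2) ?_
      (Asymptotics.isLittleO_pow_id one_lt_two)
    refine Asymptotics.IsBigO.of_bound 1 (Filter.Eventually.of_forall fun s => ?_)
    rw [one_mul, norm_pow, norm_pow]
    gcongr
    rw [Real.norm_eq_abs, Real.norm_eq_abs, abs_of_nonneg (le_max_left _ _)]
    exact max_le (abs_nonneg _) (le_abs_self _)
  · rw [max_eq_right ht.le]
    have h : HasDerivAt (fun s : ℝ => s ^ 2) (2 * t) t := by
      simpa using hasDerivAt_pow 2 t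
    refine h.congr_of_eventuallyEq ?_
    filter_upwards [lt_mem_nhds ht] with s hs
    rw [max_eq_right hs.le]

variable {k δ : ℝ}

theorem hasDerivAt_trunc (k δ t : ℝ) : HasDerivAt (trunc k δ) (truncSlope k δ t) t := by
  have h1 : HasDerivAt (fun t => t - k) 1 t := (hasDerivAt_id t).sub_const k
  have h2 : HasDerivAt (fun t => t - k - δ) 1 t := h1.sub_const δ
  have h3 : HasDerivAt (trunc k δ) _ t :=
    (((hasDerivAt_sq_max_zero (t - k)).comp t h1).sub
      ((hasDerivAt_sq_max_zero (t - k - δ)).comp t h2)).div_const (2 * δ)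
  refine h3.congr_deriv ?_
  rw [truncSlope, mul_one, mul_one, ← mul_sub, mul_div_mul_left _ _ two_ne_zero]

theorem continuous_truncSlope (k δ : ℝ) : Continuous (truncSlope k δ) := by
  unfold truncSlope
  fun_prop

theorem truncSlope_nonneg (hδ : 0 < δ) (t : ℝ) : 0 ≤ truncSlope k δ t := by
  refine div_nonneg (sub_nonneg.2 ?_) hδ.le
  exact max_le_max le_rfl (by linarith)

theorem truncSlope_le_one (hδ : 0 < δ) (t : ℝ) : truncSlope k δ t ≤ 1 := by
  rw [truncSlope, div_le_one hδ, sub_le_iff_le_add]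
  refine max_le ?_ ?_
  · have := le_max_left 0 (t - k - δ)
    linarith
  · have := le_max_right 0 (t - k - δ)
    linarith

theorem abs_truncSlope_le_one (hδ : 0 < δ) (t : ℝ) : |truncSlope k δ t| ≤ 1 := by
  rw [abs_of_nonneg (truncSlope_nonneg hδ t)]
  exact truncSlope_le_one hδ t

theorem truncSlope_of_le (hδ : 0 < δ) {t : ℝ} (ht : t ≤ k) : truncSlope k δ t = 0 := by
  rw [truncSlope, max_eq_left (by linarith), max_eq_left (by linarith), sub_self, zero_div]

theorem trunc_of_le (hδ : 0 < δ) {t : ℝ} (ht : t ≤ k) : trunc k δ t = 0 := by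
  rw [trunc, max_eq_left (by linarith), max_eq_left (by linarith), sub_self, zero_div]

theorem trunc_nonneg (hδ : 0 < δ) (t : ℝ) : 0 ≤ trunc k δ t := by
  refine div_nonneg (sub_nonneg.2 ?_) (by positivity)
  have : max 0 (t - k - δ) ≤ max 0 (t - k) := max_le_max le_rfl (by linarith)
  have := le_max_left 0 (t - k - δ)
  gcongr

theorem trunc_le (hδ : 0 < δ) {t : ℝ} (ht : k ≤ t) : trunc k δ t ≤ t - k := by
  rw [trunc, div_le_iff₀ (by positivity), max_eq_right (by linarith)]
  rcases le_total (t - k) δ with h | h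
  · rw [max_eq_left (by linarith)]
    nlinarith
  · rw [max_eq_right (by linarith)]
    nlinarith

theorem half_le_trunc (hδ : 0 < δ) {t : ℝ} (ht : k + δ ≤ t) : δ / 2 ≤ trunc k δ t := by
  rw [trunc, le_div_iff₀ (by positivity), max_eq_right (by linarith), max_eq_right (by linarith)]
  nlinarith

end Truncation

/-! ### Boundedness of functions with square integrable Laplacian -/

section SupBound

open Filter Topology Metric

variable {d : ℕ} {T : Set (EuclideanSpace ℝ (Fin d) → ℝ)} {Ω : Set (EuclideanSpace ℝ (Fin d))}
  {u u' g : EuclideanSpace ℝ (Fin d) → ℝ}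

theorem HasWeakGradient.congr {G : EuclideanSpace ℝ (Fin d) → EuclideanSpace ℝ (Fin d)}
    (h : HasWeakGradient T Ω u G) (huu' : u =ᵐ[volume.restrict Ω] u') :
    HasWeakGradient T Ω u' G := by
  refine ⟨h.memLp.ae_eq huu', h.memLp_grad, fun φ hφ => ?_⟩
  rw [← h.integral_eq φ hφ]
  refine integral_congr_ae ?_
  filter_upwards [huu'] with x hx
  rw [hx]

theorem HasLaplacian.congr (h : HasLaplacian T Ω u g) (huu' : u =ᵐ[volume.restrict Ω] u') :
    HasLaplacian T Ω u' g := by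
  obtain ⟨hg, G, hG, hw⟩ := h
  exact ⟨hg, G, hG.congr huu', hw⟩

theorem HasLaplacian.neg (h : HasLaplacian T Ω u g) :
    HasLaplacian T Ω (fun x => -u x) (fun x => -g x) := by
  obtain ⟨hg, G, hG, hw⟩ := h
  refine ⟨hg.neg, fun x => -G x, ⟨hG.memLp.neg, hG.memLp_grad.neg, fun φ hφ => ?_⟩,
    fun w W hW => ?_⟩
  · simp only [neg_smul, smul_neg, integral_neg, hG.integral_eq φ hφ]
  · simp only [inner_neg_left, neg_mul, integral_neg, hw w W hW]

theorem HasLaplacian.memLp (h : HasLaplacian T Ω u g) : MemLp u 2 (volume.restrict Ω) :=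
  h.2.choose_spec.1.memLp

theorem eLpNorm_two_sq {α F : Type*} [MeasurableSpace α] [NormedAddCommGroup F] (μ : Measure α)
    (f : α → F) : eLpNorm f 2 μ ^ 2 = ∫⁻ x, ‖f x‖ₑ ^ 2 ∂μ := by
  have := eLpNorm_nnreal_pow_eq_lintegral (μ := μ) (f := f) (p := 2) two_ne_zero
  simpa using this

/-- The energy estimate for the truncation `w` of `u` at a level `k`. -/
theorem lintegral_trunc_sq_add_le (hchain : AdmitsChainRule T Ω)
    (h : HasLaplacian T Ω u g) {k δ : ℝ} (hk : 0 ≤ k) (hδ : 0 < δ) :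
    ∃ W, HasWeakGradient T Ω (fun x => trunc k δ (u x)) W ∧ (∀ x, u x ≤ k → W x = 0) ∧
      ((∫⁻ x in Ω, (‖trunc k δ (u x)‖ₑ + ‖W x‖ₑ) ^ 2) / 2) ^ 2 ≤
        (eLpNorm u 2 (volume.restrict Ω) + eLpNorm g 2 (volume.restrict Ω)) ^ 2 *
          ∫⁻ x in Ω, ‖trunc k δ (u x)‖ₑ ^ 2 := by
  obtain ⟨hg, G, hG, hw⟩ := h
  have hW := hchain u G hG (trunc k δ) (truncSlope k δ) (hasDerivAt_trunc k δ)
    (continuous_truncSlope k δ) (abs_truncSlope_le_one hδ) (trunc_of_le hδ hk)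
  refine ⟨_, hW, fun x hx => by rw [truncSlope_of_le hδ hx, zero_smul], ?_⟩
  set w := fun x => trunc k δ (u x)
  set W := fun x => truncSlope k δ (u x) • G x
  have key := hw w W hW
  have iw2 : Integrable (fun x => w x * w x) (volume.restrict Ω) :=
    hW.memLp.integrable_mul hW.memLp
  have iuw : Integrable (fun x => u x * w x) (volume.restrict Ω) :=
    hG.memLp.integrable_mul hW.memLp
  have igw : Integrable (fun x => g x * w x) (volume.restrict Ω) := hg.integrable_mul hW.memLp
  have iW2 : Integrable (fun x => ‖W x‖ ^ 2) (volume.restrict Ω) :=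
    hW.memLp_grad.integrable_norm_pow two_ne_zero
  have iGW : Integrable (fun x => ⟪G x, W x⟫) (volume.restrict Ω) :=
    (hG.memLp_grad.norm.integrable_mul hW.memLp_grad.norm).mono'
      (hG.memLp_grad.aestronglyMeasurable.inner hW.memLp_grad.aestronglyMeasurable)
      (Eventually.of_forall fun x => norm_inner_le_norm _ _)
  have isum : Integrable (fun x => w x * w x + ‖W x‖ ^ 2) (volume.restrict Ω) := iw2.add iW2
  have hle : ∫ x in Ω, (w x * w x + ‖W x‖ ^ 2) ≤ ∫ x in Ω, (u x - g x) * w x := by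
    have e : ∫ x in Ω, (u x - g x) * w x = ∫ x in Ω, (u x * w x + ⟪G x, W x⟫) := by
      rw [integral_add iuw iGW, key]
      simp_rw [sub_mul]
      rw [integral_sub iuw igw, sub_eq_add_neg]
    rw [e]
    refine integral_mono isum (iuw.add iGW) fun x => ?_
    have h1 : w x * w x ≤ u x * w x := by
      rcases le_total (u x) k with hx | hx
      · simp [w, trunc_of_le hδ hx]
      · have h1 := trunc_le hδ hx
        have h2 : 0 ≤ w x := trunc_nonneg hδ (u x)
        have h3 : w x ≤ u x := h1.trans (by linarith)
        gcongr
    have h2 : ‖W x‖ ^ 2 ≤ ⟪G x, W x⟫ := by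
      have s0 : 0 ≤ truncSlope k δ (u x) := truncSlope_nonneg hδ _
      have s1 : truncSlope k δ (u x) ≤ 1 := truncSlope_le_one hδ _
      simp only [W]
      rw [norm_smul, inner_smul_right, real_inner_self_eq_norm_sq, Real.norm_of_nonneg s0, mul_pow]
      have : truncSlope k δ (u x) ^ 2 ≤ truncSlope k δ (u x) := by nlinarith
      gcongr
    exact add_le_add h1 h2
  have hY : (∫⁻ x in Ω, (‖w x‖ₑ + ‖W x‖ₑ) ^ 2) / 2 ≤
      ENNReal.ofReal (∫ x in Ω, (w x * w x + ‖W x‖ ^ 2)) := by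
    rw [ofReal_integral_eq_lintegral_ofReal isum
      (Eventually.of_forall fun x => add_nonneg (mul_self_nonneg _) (sq_nonneg _)),
      ENNReal.div_le_iff (by simp) (by simp), ← lintegral_mul_const' _ _ (by simp)]
    refine lintegral_mono fun x => ?_
    have hx : 0 ≤ w x * w x + ‖W x‖ ^ 2 := add_nonneg (mul_self_nonneg _) (sq_nonneg _)
    have h2 : ENNReal.ofReal (w x * w x + ‖W x‖ ^ 2) * 2 =
        ENNReal.ofReal ((w x * w x + ‖W x‖ ^ 2) * 2) := by
      rw [ENNReal.ofReal_mul hx]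
      simp
    dsimp only
    rw [h2, ← ofReal_norm, ← ofReal_norm, ← ENNReal.ofReal_add (norm_nonneg _) (norm_nonneg _),
      ← ENNReal.ofReal_pow (by positivity)]
    apply ENNReal.ofReal_le_ofReal
    rw [Real.norm_eq_abs]
    nlinarith [sq_nonneg (|w x| - ‖W x‖), abs_mul_abs_self (w x)]
  have hZ : ENNReal.ofReal (∫ x in Ω, (w x * w x + ‖W x‖ ^ 2)) ≤
      ∫⁻ x in Ω, ‖u x - g x‖ₑ * ‖w x‖ₑ := by
    refine (ENNReal.ofReal_le_ofReal hle).trans ?_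
    refine (Real.ofReal_le_enorm _).trans ?_
    refine (enorm_integral_le_lintegral_enorm _).trans ?_
    simp_rw [enorm_mul]
    exact le_rfl
  have hum : AEMeasurable (fun x => ‖u x - g x‖ₑ) (volume.restrict Ω) :=
    (hG.memLp.aestronglyMeasurable.sub hg.aestronglyMeasurable).enorm
  have hwm : AEMeasurable (fun x => ‖w x‖ₑ) (volume.restrict Ω) :=
    hW.memLp.aestronglyMeasurable.enorm
  calc ((∫⁻ x in Ω, (‖w x‖ₑ + ‖W x‖ₑ) ^ 2) / 2) ^ 2
      ≤ (∫⁻ x in Ω, ‖u x - g x‖ₑ * ‖w x‖ₑ) ^ 2 := by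
        gcongr
        exact hY.trans hZ
    _ ≤ (∫⁻ x in Ω, ‖u x - g x‖ₑ ^ 2) * ∫⁻ x in Ω, ‖w x‖ₑ ^ 2 := sq_lintegral_mul_le hum hwm
    _ ≤ _ := by
        gcongr
        have := eLpNorm_two_sq (volume.restrict Ω) (fun x => u x - g x)
        rw [← this]
        gcongr
        exact eLpNorm_sub_le hG.memLp.aestronglyMeasurable hg.aestronglyMeasurable (by norm_num)

/-- The potential estimate for all functions of the Sobolev space. -/
def RieszBound (T : Set (EuclideanSpace ℝ (Fin d) → ℝ)) (Ω : Set (EuclideanSpace ℝ (Fin d)))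
    (C : ℝ) : Prop :=
  ∀ u G, HasWeakGradient T Ω u G → ∀ᵐ x ∂volume.restrict Ω, ‖u x‖ₑ ≤
    ENNReal.ofReal C * ∫⁻ y in Ω, (‖u y‖ₑ + ‖G y‖ₑ) * (‖x - y‖ₑ ^ (d - 1))⁻¹

/-- The decay of the superlevel sets of a function with square integrable Laplacian: the measure of
`{u > h}` is controlled by the power `4 / 3` of that of `{u > k}`. -/
theorem measure_superlevel_le (hΩm : MeasurableSet Ω) (hchain : AdmitsChainRule T Ω) {C : ℝ}
    (hC : 0 ≤ C) (hriesz : RieszBound T Ω C)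
    {c v : ℝ} (hc : 0 ≤ c) (hker : ∀ (A : Set (EuclideanSpace ℝ (Fin d))) (b : ℝ), 0 < b → b ≤ v →
      volume A ≤ ENNReal.ofReal (b ^ 3) → ∀ x,
        ∫⁻ y in A, (‖x - y‖ₑ ^ (d - 1))⁻¹ ≤ ENNReal.ofReal (c * b))
    (hu : Measurable u) (h : HasLaplacian T Ω u g) {N : ℝ} (hN0 : 0 ≤ N)
    (hN : eLpNorm u 2 (volume.restrict Ω) + eLpNorm g 2 (volume.restrict Ω) ≤ ENNReal.ofReal N)
    {k h b : ℝ} (hk : 0 ≤ k) (hkh : k < h) (hb : 0 < b) (hbv : b ≤ v)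
    (hA : volume (Ω ∩ {x | k < u x}) ≤ ENNReal.ofReal (b ^ 3)) :
    ENNReal.ofReal (((h - k) / 2) ^ 2) * volume (Ω ∩ {x | h < u x}) ≤
      ENNReal.ofReal (4 * N ^ 2 * (C * c) ^ 4 * b ^ 4) := by
  have hδ : 0 < h - k := sub_pos.2 hkh
  obtain ⟨W, hW, hW0, hen⟩ := lintegral_trunc_sq_add_le hchain ‹_› hk hδ
  set w := fun x => trunc k (h - k) (u x)
  set A := Ω ∩ {x | k < u x}
  have hAm : MeasurableSet A := hΩm.inter (measurableSet_lt measurable_const hu)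
  set X := ∫⁻ x in Ω, ‖w x‖ₑ ^ 2
  set Y := ∫⁻ x in Ω, (‖w x‖ₑ + ‖W x‖ₑ) ^ 2
  set κ : EuclideanSpace ℝ (Fin d) → EuclideanSpace ℝ (Fin d) → ℝ≥0∞ :=
    fun x y => (‖x - y‖ₑ ^ (d - 1))⁻¹
  have hκm : Measurable (Function.uncurry κ) := by
    have : Measurable fun p : EuclideanSpace ℝ (Fin d) × EuclideanSpace ℝ (Fin d) =>
        (‖p.1 - p.2‖ₑ ^ (d - 1))⁻¹ := by fun_prop
    exact this
  have hwA : ∀ x ∈ Ω, x ∉ A → w x = 0 := fun x hx hxA =>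
    trunc_of_le hδ (not_lt.1 fun hlt => hxA ⟨hx, hlt⟩)
  have hWA : ∀ x ∈ Ω, x ∉ A → W x = 0 := fun x hx hxA =>
    hW0 x (not_lt.1 fun hlt => hxA ⟨hx, hlt⟩)
  -- both `w` and `W` vanish outside the superlevel set, so integrals may be restricted to it
  have hrestrict : ∀ F : EuclideanSpace ℝ (Fin d) → ℝ≥0∞, (∀ x ∈ Ω, x ∉ A → F x = 0) →
      ∫⁻ x in Ω, F x = ∫⁻ x in A, F x := by
    intro F hF
    rw [← lintegral_inter_add_sdiff (μ := volume) F Ω hAm,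
      Set.inter_eq_self_of_subset_right Set.inter_subset_left,
      setLIntegral_eq_zero (hΩm.diff hAm) (fun x hx => hF x hx.1 hx.2), add_zero]
  have hae : ∀ᵐ x ∂volume.restrict A, ‖w x‖ₑ ≤
      ENNReal.ofReal C * ∫⁻ y in A, (‖w y‖ₑ + ‖W y‖ₑ) * κ x y := by
    have := ae_mono (Measure.restrict_mono (Set.inter_subset_left (s := Ω) (t := {x | k < u x}))
      le_rfl) (hriesz w W hW)
    filter_upwards [this] with x hx
    rwa [hrestrict _ fun y hy hyA => by rw [hwA y hy hyA, hWA y hy hyA]; simp] at hx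
  have hfm : AEMeasurable (fun y => ‖w y‖ₑ + ‖W y‖ₑ) (volume.restrict A) :=
    ((hW.memLp.aestronglyMeasurable.enorm).add
      (hW.memLp_grad.aestronglyMeasurable.enorm)).mono_measure
      (Measure.restrict_mono Set.inter_subset_left le_rfl)
  set K := ENNReal.ofReal ((C * (c * b)) ^ 2)
  have hXY : X ≤ K * Y := by
    calc X = ∫⁻ x in A, ‖w x‖ₑ ^ 2 :=
          hrestrict _ fun y hy hyA => by rw [hwA y hy hyA]; simp
      _ ≤ ∫⁻ x in A, ENNReal.ofReal C ^ 2 *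
            (∫⁻ y in A, (‖w y‖ₑ + ‖W y‖ₑ) * κ x y) ^ 2 := by
          refine lintegral_mono_ae ?_
          filter_upwards [hae] with x hx
          rw [← mul_pow]
          gcongr
      _ = ENNReal.ofReal C ^ 2 * ∫⁻ x in A,
            (∫⁻ y in A, (‖w y‖ₑ + ‖W y‖ₑ) * κ x y) ^ 2 :=
          lintegral_const_mul' _ _ (by simp)
      _ ≤ ENNReal.ofReal C ^ 2 * (ENNReal.ofReal (c * b) ^ 2 *
            ∫⁻ y in A, (‖w y‖ₑ + ‖W y‖ₑ) ^ 2) := by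
          gcongr
          refine lintegral_sq_lintegral_kernel_le hκm (fun x y => ?_) (hker A b hb hbv hA) hfm
          simp only [κ]
          rw [← enorm_neg, neg_sub]
      _ ≤ K * Y := by
          rw [← mul_assoc, ← mul_pow, ← ENNReal.ofReal_mul hC,
            ← ENNReal.ofReal_pow (by positivity)]
          gcongr
          exact lintegral_mono_set Set.inter_subset_left
  have hX : X ≠ ⊤ := by
    have := hW.memLp.eLpNorm_ne_top
    rw [show X = eLpNorm w 2 (volume.restrict Ω) ^ 2 from (eLpNorm_two_sq _ _).symm]
    exact ENNReal.pow_ne_top this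
  have hX2 : X ≤ ENNReal.ofReal (4 * N ^ 2 * (C * c) ^ 4 * b ^ 4) := by
    have h1 : X * X ≤ ENNReal.ofReal (4 * N ^ 2 * (C * c) ^ 4 * b ^ 4) * X := by
      calc X * X = X ^ 2 := (sq X).symm
        _ ≤ (K * Y) ^ 2 := by gcongr
        _ = 4 * K ^ 2 * (Y / 2) ^ 2 := by
            have hY2 : Y = 2 * (Y / 2) := (ENNReal.mul_div_cancel (by simp) (by simp)).symm
            conv_lhs => rw [hY2]
            ring
        _ ≤ 4 * K ^ 2 * (ENNReal.ofReal N ^ 2 * X) := by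
            gcongr
            exact hen.trans (by gcongr)
        _ = ENNReal.ofReal (4 * N ^ 2 * (C * c) ^ 4 * b ^ 4) * X := by
            have : (4 : ℝ≥0∞) = ENNReal.ofReal 4 := by simp
            rw [← mul_assoc, this, ← ENNReal.ofReal_pow (by positivity),
              ← ENNReal.ofReal_pow hN0, ← ENNReal.ofReal_mul (by norm_num),
              ← ENNReal.ofReal_mul (by positivity)]
            congr 2
            ring
    rcases eq_or_ne X 0 with h0 | h0
    · rw [h0]; exact zero_le
    · exact (ENNReal.mul_le_mul_iff_left h0 hX).1 h1
  refine le_trans ?_ hX2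
  have hBm : MeasurableSet (Ω ∩ {x | h < u x}) :=
    hΩm.inter (measurableSet_lt measurable_const hu)
  calc ENNReal.ofReal (((h - k) / 2) ^ 2) * volume (Ω ∩ {x | h < u x})
      = ∫⁻ _ in Ω ∩ {x | h < u x}, ENNReal.ofReal (((h - k) / 2) ^ 2) := by simp
    _ ≤ ∫⁻ x in Ω ∩ {x | h < u x}, ‖w x‖ₑ ^ 2 := by
        refine setLIntegral_mono_ae' hBm (Eventually.of_forall fun x hx => ?_)
        rw [← ofReal_norm, ← ENNReal.ofReal_pow (norm_nonneg _)]
        apply ENNReal.ofReal_le_ofReal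
        have hx' : h < u x := hx.2
        have h1 : (h - k) / 2 ≤ w x := half_le_trunc hδ (by linarith)
        gcongr
        exact h1.trans (le_abs_self _)
    _ ≤ X := lintegral_mono_set Set.inter_subset_left

/-- A quantity that decays superlinearly from level to level vanishes at a finite level. -/
theorem eq_zero_of_superlinear_decay {a : ℝ → ℝ≥0∞} (ha : Antitone a) {v Q : ℝ} (hv : 0 < v)
    (hQ : 0 ≤ Q) (h0 : a 0 ≤ ENNReal.ofReal (v ^ 3))
    (hdec : ∀ k h b : ℝ, 0 ≤ k → k < h → 0 < b → b ≤ v → a k ≤ ENNReal.ofReal (b ^ 3) →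
      ENNReal.ofReal (((h - k) / 2) ^ 2) * a h ≤ ENNReal.ofReal (Q * b ^ 4)) :
    a (1024 * Q * v + 1) = 0 := by
  set K := 1024 * Q * v + 1 with hK
  have hKpos : 1 ≤ K := by
    have : 0 ≤ 1024 * Q * v := by positivity
    linarith
  -- the levels `K (1 - 2⁻ⁿ)` increase to `K`
  have key : ∀ n : ℕ, a (K * (1 - (1 / 2) ^ n)) ≤ ENNReal.ofReal ((v * (1 / 4) ^ n) ^ 3) := by
    intro n
    induction n with
    | zero => simpa using h0
    | succ n ih =>
      have hp : (0 : ℝ) < (1 / 2) ^ n := by positivity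
      have hp1 : ((1 : ℝ) / 2) ^ n ≤ 1 := pow_le_one₀ (by norm_num) (by norm_num)
      have hgap : K * (1 - (1 / 2) ^ (n + 1)) - K * (1 - (1 / 2) ^ n) = K * (1 / 2) ^ n / 2 := by
        rw [pow_succ]; ring
      have hq : (0 : ℝ) < (1 / 4) ^ n := by positivity
      have hq1 : ((1 : ℝ) / 4) ^ n ≤ 1 := pow_le_one₀ (by norm_num) (by norm_num)
      have hpq : (((1 : ℝ) / 2) ^ n) ^ 2 = (1 / 4) ^ n := by
        rw [← pow_mul, mul_comm, pow_mul]; norm_num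
      have h1 := hdec _ (K * (1 - (1 / 2) ^ (n + 1))) _
        (mul_nonneg (by linarith) (by linarith)) (by nlinarith) (mul_pos hv hq)
        (mul_le_of_le_one_right hv.le hq1) ih
      rw [hgap] at h1
      have hpos : 0 < (K * (1 / 2) ^ n / 2 / 2) ^ 2 := by positivity
      rw [mul_comm, ← ENNReal.le_div_iff_mul_le (Or.inl (ENNReal.ofReal_pos.2 hpos).ne')
        (Or.inl ENNReal.ofReal_ne_top), ← ENNReal.ofReal_div_of_pos hpos] at h1
      refine h1.trans (ENNReal.ofReal_le_ofReal ?_)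
      rw [div_le_iff₀ hpos]
      have e1 : (K * (1 / 2) ^ n / 2 / 2) ^ 2 = K ^ 2 * (1 / 4) ^ n / 16 := by
        rw [← hpq]; ring
      have e2 : (v * (1 / 4 : ℝ) ^ (n + 1)) ^ 3 * (K ^ 2 * (1 / 4) ^ n / 16) =
          K ^ 2 * (v ^ 3 * ((1 / 4) ^ n) ^ 4) / 1024 := by
        rw [pow_succ]; ring
      rw [e1, e2]
      have hKK : 1024 * Q * v ≤ K ^ 2 := by nlinarith
      have : 0 ≤ v ^ 3 * ((1 / 4 : ℝ) ^ n) ^ 4 := by positivity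
      nlinarith
  refine le_antisymm ?_ zero_le
  have hlim : Tendsto (fun n : ℕ => ENNReal.ofReal ((v * (1 / 4 : ℝ) ^ n) ^ 3)) atTop (𝓝 0) := by
    have h1 : Tendsto (fun n : ℕ => (v * (1 / 4 : ℝ) ^ n) ^ 3) atTop (𝓝 ((v * 0) ^ 3)) :=
      ((tendsto_pow_atTop_nhds_zero_of_lt_one (by norm_num) (by norm_num)).const_mul v).pow 3
    have := ENNReal.tendsto_ofReal h1
    simpa using this
  refine ge_of_tendsto hlim (Eventually.of_forall fun n => ?_)
  refine le_trans (ha ?_) (key n)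
  have hp : (0 : ℝ) < (1 / 2) ^ n := by positivity
  nlinarith

/-- Stampacchia's bound: in dimensions two and three a function with square integrable Laplacian
and the boundary condition encoded by `T` is bounded, uniformly in terms of the `L²` norms. -/
theorem exists_ae_abs_le (hd : d = 2 ∨ d = 3) (hΩm : MeasurableSet Ω)
    (hΩ : Bornology.IsBounded Ω) (hchain : AdmitsChainRule T Ω) {C : ℝ} (hC : 0 ≤ C)
    (hriesz : RieszBound T Ω C) {N : ℝ} (hN0 : 0 ≤ N) :
    ∃ M : ℝ, ∀ u g, HasLaplacian T Ω u g →
      eLpNorm u 2 (volume.restrict Ω) + eLpNorm g 2 (volume.restrict Ω) ≤ ENNReal.ofReal N →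
      ∀ᵐ x ∂volume.restrict Ω, ‖u x‖ ≤ M := by
  set v := volume.real Ω + 1
  have hv1 : 1 ≤ v := by
    have : 0 ≤ volume.real Ω := measureReal_nonneg
    linarith
  obtain ⟨c, hc, hker⟩ := exists_setLIntegral_riesz_kernel_le hd v
  set Q := 4 * N ^ 2 * (C * c) ^ 4
  have hQ : 0 ≤ Q := by positivity
  have hvol : volume Ω ≤ ENNReal.ofReal (v ^ 3) := by
    rw [← ENNReal.ofReal_toReal hΩ.measure_lt_top.ne]
    apply ENNReal.ofReal_le_ofReal
    have h1 : (volume Ω).toReal ≤ v := by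
      change volume.real Ω ≤ v
      linarith
    refine h1.trans ?_
    nlinarith [sq_nonneg v, mul_nonneg (sub_nonneg.2 hv1) (sub_nonneg.2 hv1)]
  -- the upper bound; the lower one follows by applying it to `-u`
  have upper : ∀ u g, HasLaplacian T Ω u g →
      eLpNorm u 2 (volume.restrict Ω) + eLpNorm g 2 (volume.restrict Ω) ≤ ENNReal.ofReal N →
      ∀ᵐ x ∂volume.restrict Ω, u x ≤ 1024 * Q * v + 1 := by
    intro u g h hN
    obtain ⟨u', hu', huu'⟩ := h.memLp.aestronglyMeasurable.aemeasurable
    have h' := h.congr huu'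
    rw [eLpNorm_congr_ae huu'] at hN
    have := eq_zero_of_superlinear_decay (a := fun k => volume (Ω ∩ {x | k < u' x}))
      (fun k l hkl => measure_mono fun x hx => ⟨hx.1, lt_of_le_of_lt hkl hx.2⟩)
      (v := v) (Q := Q) (by linarith) hQ ((measure_mono Set.inter_subset_left).trans hvol)
      (fun k l b hk hkl hb hbv hA =>
        measure_superlevel_le hΩm hchain hC hriesz hc hker hu' h' hN0 hN hk hkl hb hbv hA)
    have hz : ∀ᵐ x ∂volume.restrict Ω, u' x ≤ 1024 * Q * v + 1 := by
      rw [ae_iff, Measure.restrict_apply']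
      · refine le_antisymm (le_trans (measure_mono fun x hx => ?_) this.le) zero_le
        exact ⟨hx.2, not_le.1 hx.1⟩
      · exact hΩm
    filter_upwards [huu', hz] with x h1 h2
    rwa [h1]
  refine ⟨1024 * Q * v + 1, fun u g h hN => ?_⟩
  have hneg : eLpNorm (fun x => -u x) 2 (volume.restrict Ω) +
      eLpNorm (fun x => -g x) 2 (volume.restrict Ω) ≤ ENNReal.ofReal N := by
    have e1 : eLpNorm (fun x => -u x) 2 (volume.restrict Ω) = eLpNorm u 2 (volume.restrict Ω) :=
      eLpNorm_neg u 2 _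
    have e2 : eLpNorm (fun x => -g x) 2 (volume.restrict Ω) = eLpNorm g 2 (volume.restrict Ω) :=
      eLpNorm_neg g 2 _
    rwa [e1, e2]
  filter_upwards [upper u g h hN, upper _ _ h.neg hneg] with x h1 h2
  rw [Real.norm_eq_abs, abs_le]
  constructor <;> linarith

end SupBound

/-! ### Cone conditions -/

section Cones

open Filter Topology Metric

variable {d : ℕ} {Ω : Set (EuclideanSpace ℝ (Fin d))}

theorem ConeCondition.hasUniformCones (h : ConeCondition Ω) : HasUniformCones Ω := by
  obtain ⟨h, c, hh, hc0, hc1, hcone⟩ := h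
  have hρ : 0 < (1 - c) * h / 8 := by
    have : 0 < 1 - c := by linarith
    positivity
  refine ⟨(1 - c) * h / 8, hρ, fun x hx => ?_⟩
  obtain ⟨e, he, hsub⟩ := hcone x hx
  -- a ball on the axis, halfway up, with radius small compared with the opening of the cone
  refine ⟨x + (h / 2) • e, fun z hz t ht0 ht1 => hsub ?_⟩
  set ξ := z - (x + (h / 2) • e)
  have hξ : ‖ξ‖ ≤ (1 - c) * h / 8 := by rwa [mem_closedBall, dist_eq_norm] at hz
  have hzx : z - x = (h / 2) • e + ξ := by simp only [ξ]; abel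
  have hn : ‖z - x‖ ≤ h / 2 + (1 - c) * h / 8 := by
    rw [hzx]
    refine (norm_add_le _ _).trans ?_
    rw [norm_smul, he, Real.norm_of_nonneg (by positivity), mul_one]
    linarith
  have hi : h / 2 - (1 - c) * h / 8 ≤ ⟪z - x, e⟫ := by
    rw [hzx, inner_add_left, real_inner_smul_left, real_inner_self_eq_norm_sq, he]
    have := abs_real_inner_le_norm ξ e
    rw [he, mul_one] at this
    have := (abs_le.1 (this.trans hξ)).1
    linarith
  have hlt : ‖z - x‖ < h := by nlinarith
  have hcl : c * ‖z - x‖ < ⟪z - x, e⟫ := by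
    have : c * ‖z - x‖ ≤ c * (h / 2 + (1 - c) * h / 8) := by gcongr
    have h3 : 0 < (1 - c) * h := by nlinarith
    nlinarith
  have hsubx : x + t • (z - x) - x = t • (z - x) := by abel
  refine ⟨?_, ?_⟩
  · rw [hsubx, norm_smul, Real.norm_of_nonneg ht0.le]
    exact (mul_le_of_le_one_left (norm_nonneg _) ht1).trans_lt hlt
  · rw [hsubx, norm_smul, Real.norm_of_nonneg ht0.le, real_inner_smul_left, mul_left_comm]
    exact mul_lt_mul_of_pos_left hcl ht0

theorem hasUniformCones_openBox {a b : Fin d → ℝ} (hab : ∀ i, a i < b i) :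
    HasUniformCones (openBox a b) := by
  have hm : WithLp.toLp 2 (fun i => (a i + b i) / 2) ∈ openBox a b := fun i => by
    have := hab i
    constructor <;> simp only <;> linarith
  obtain ⟨ρ, hρ, hsub⟩ := nhds_basis_closedBall.mem_iff.1 (isOpen_openBox.mem_nhds hm)
  refine ⟨ρ, hρ, fun x hx => ⟨WithLp.toLp 2 fun i => (a i + b i) / 2, fun z hz t ht0 ht1 i => ?_⟩⟩
  obtain ⟨h1, h2⟩ := hsub hz i
  obtain ⟨h3, h4⟩ := hx i
  simp only [PiLp.add_apply, PiLp.smul_apply, PiLp.sub_apply, smul_eq_mul]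
  constructor <;> nlinarith

theorem rieszBound_periodicTests {a b : Fin d → ℝ} (hab : ∀ i, a i < b i) {C : ℝ}
    (h : RieszBound (compactTests (openBox a b)) (openBox a b) C) :
    RieszBound (periodicTests a b) (openBox a b) C :=
  fun u G hG => h u G (hG.compactTests_of_periodicTests hab)

end Cones

/-! ### The energy -/

section Energy

open Filter Topology Metric

variable {d : ℕ} {T : Set (EuclideanSpace ℝ (Fin d) → ℝ)} {Ω : Set (EuclideanSpace ℝ (Fin d))}

theorem eLpNorm_two_le_of_integral_sq_le {f : EuclideanSpace ℝ (Fin d) → ℝ}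
    (hf : MemLp f 2 (volume.restrict Ω)) {S : ℝ} (hS : 0 ≤ S) (h : ∫ x in Ω, f x ^ 2 ≤ S) :
    eLpNorm f 2 (volume.restrict Ω) ≤ ENNReal.ofReal (S + 1) := by
  refine (ENNReal.pow_le_pow_left_iff two_ne_zero).1 ?_
  rw [eLpNorm_two_sq, ← ENNReal.ofReal_pow (by positivity)]
  have e : ∀ x, ‖f x‖ₑ ^ 2 = ENNReal.ofReal (f x ^ 2) := fun x => by
    rw [← ofReal_norm, ← ENNReal.ofReal_pow (norm_nonneg _), Real.norm_eq_abs, sq_abs]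
  simp_rw [e]
  rw [← ofReal_integral_eq_lintegral_ofReal hf.integrable_sq
    (Eventually.of_forall fun x => sq_nonneg _)]
  apply ENNReal.ofReal_le_ofReal
  nlinarith

/-- If functions with square integrable Laplacian are bounded in terms of their `L²` norms, then
functions with energy at most that of `v` have a common bound. -/
theorem exists_eLpNorm_top_le_of_energy_le (hΩ : Bornology.IsBounded Ω)
    (hsup : ∀ N : ℝ, 0 ≤ N → ∃ M : ℝ, ∀ u g, HasLaplacian T Ω u g →
      eLpNorm u 2 (volume.restrict Ω) + eLpNorm g 2 (volume.restrict Ω) ≤ ENNReal.ofReal N →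
      ∀ᵐ x ∂volume.restrict Ω, ‖u x‖ ≤ M)
    {v : EuclideanSpace ℝ (Fin d) → ℝ} (hv : Admissible T Ω v) :
    ∃ M : ℝ, ∀ ε : ℝ, 0 < ε → ε < 1 → ∀ u : EuclideanSpace ℝ (Fin d) → ℝ, Admissible T Ω u →
      pfcEnergy T Ω ε u ≤ pfcEnergy T Ω ε v →
      eLpNorm u ∞ (volume.restrict Ω) ≤ ENNReal.ofReal M := by
  have := isFiniteMeasure_restrict_of_isBounded hΩ
  -- admissible functions are bounded, so that all terms of the energy are integrable
  have hint : ∀ u, Admissible T Ω u → Integrable (fun x => u x ^ 2) (volume.restrict Ω) ∧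
      Integrable (fun x => u x ^ 4) (volume.restrict Ω) ∧
      Integrable (fun x => (u x + lapl T Ω u x) ^ 2) (volume.restrict Ω) := by
    intro u hu
    have hL := hasLaplacian_lapl hu
    have h1 := hL.memLp
    obtain ⟨M, hM⟩ := hsup (eLpNorm u 2 (volume.restrict Ω) +
      eLpNorm (lapl T Ω u) 2 (volume.restrict Ω)).toReal ENNReal.toReal_nonneg
    have hb := hM u _ hL (ENNReal.ofReal_toReal
      (ENNReal.add_ne_top.2 ⟨h1.eLpNorm_ne_top, hL.1.eLpNorm_ne_top⟩)).ge
    refine ⟨h1.integrable_sq, ?_, (h1.add hL.1).integrable_sq⟩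
    refine Integrable.of_bound (h1.aestronglyMeasurable.pow 4) (M ^ 4) ?_
    filter_upwards [hb] with x hx
    rw [norm_pow]
    gcongr
  obtain ⟨v2, v4, vL⟩ := hint v hv
  set M₀ := ∫ x in Ω, (1 / 4 * v x ^ 4 + 1 / 2 * (v x + lapl T Ω v x) ^ 2)
  have hM₀ : 0 ≤ M₀ := integral_nonneg fun x => by positivity
  set R := M₀ + volume.real Ω
  have hR : 0 ≤ R := add_nonneg hM₀ measureReal_nonneg
  obtain ⟨M, hM⟩ := hsup ((2 * R + 1) + (8 * R + 1)) (by positivity)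
  refine ⟨M, fun ε hε0 hε1 u hu hE => ?_⟩
  obtain ⟨u2, u4, uL⟩ := hint u hu
  have hL := hasLaplacian_lapl hu
  set p := lapl T Ω u
  have hupper : pfcEnergy T Ω ε v ≤ M₀ := by
    refine integral_mono (((v4.const_mul _).sub (v2.const_mul _)).add (vL.const_mul _))
      ((v4.const_mul _).add (vL.const_mul _)) fun x => ?_
    dsimp only
    have : 0 ≤ ε / 2 * v x ^ 2 := by positivity
    linarith
  have hlower : ∫ x in Ω, (1 / 2 * u x ^ 2 + 1 / 2 * (u x + p x) ^ 2 - 1) ≤ pfcEnergy T Ω ε u := by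
    refine integral_mono (((u2.const_mul _).add (uL.const_mul _)).sub (integrable_const _))
      (((u4.const_mul _).sub (u2.const_mul _)).add (uL.const_mul _)) fun x => ?_
    dsimp only
    -- `t² / 4 - t / 2 ≥ t / 2 - 1` for `t = u²`
    have h1 : ε / 2 * u x ^ 2 ≤ 1 / 2 * u x ^ 2 := by
      have := sq_nonneg (u x)
      nlinarith
    nlinarith [sq_nonneg (u x ^ 2 - 2)]
  have hsum : ∫ x in Ω, (1 / 2 * u x ^ 2 + 1 / 2 * (u x + p x) ^ 2 - 1) =
      1 / 2 * (∫ x in Ω, u x ^ 2) + 1 / 2 * (∫ x in Ω, (u x + p x) ^ 2) - volume.real Ω := by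
    have hs : Integrable (fun x => 1 / 2 * u x ^ 2 + 1 / 2 * (u x + p x) ^ 2)
        (volume.restrict Ω) := (u2.const_mul _).add (uL.const_mul _)
    rw [integral_sub hs (integrable_const _), integral_add (u2.const_mul _) (uL.const_mul _), integral_const_mul, integral_const_mul]
    simp
  have n1 : 0 ≤ ∫ x in Ω, u x ^ 2 := integral_nonneg fun x => sq_nonneg _
  have n2 : 0 ≤ ∫ x in Ω, (u x + p x) ^ 2 := integral_nonneg fun x => sq_nonneg _
  have hu2 : ∫ x in Ω, u x ^ 2 ≤ 2 * R := by linarith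
  have hp2 : ∫ x in Ω, p x ^ 2 ≤ 8 * R := by
    have : ∫ x in Ω, p x ^ 2 ≤ ∫ x in Ω, (2 * u x ^ 2 + 2 * (u x + p x) ^ 2) := by
      refine integral_mono hL.1.integrable_sq ((u2.const_mul _).add (uL.const_mul _)) fun x => ?_
      dsimp only
      nlinarith [sq_nonneg (2 * u x + p x)]
    rw [integral_add (u2.const_mul _) (uL.const_mul _), integral_const_mul,
      integral_const_mul] at this
    linarith
  have hb := hM u p hL (by
    rw [ENNReal.ofReal_add (by positivity) (by positivity)]
    exact add_le_add (eLpNorm_two_le_of_integral_sq_le hL.memLp (by positivity) hu2)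
      (eLpNorm_two_le_of_integral_sq_le hL.1 (by positivity) hp2))
  rw [eLpNorm_exponent_top]
  exact eLpNormEssSup_le_of_ae_bound hb

/-- The bound for one of the two boundary conditions, given the chain rule and the potential
estimate. -/
theorem exists_eLpNorm_top_le (hd : d = 2 ∨ d = 3) (hΩo : IsOpen Ω) (hΩ : Bornology.IsBounded Ω)
    (hchain : AdmitsChainRule T Ω) {C : ℝ} (hC : 0 ≤ C) (hriesz : RieszBound T Ω C)
    {v : EuclideanSpace ℝ (Fin d) → ℝ} (hv : Admissible T Ω v) :
    ∃ M : ℝ, ∀ ε : ℝ, 0 < ε → ε < 1 → ∀ u : EuclideanSpace ℝ (Fin d) → ℝ, Admissible T Ω u →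
      pfcEnergy T Ω ε u ≤ pfcEnergy T Ω ε v →
      eLpNorm u ∞ (volume.restrict Ω) ≤ ENNReal.ofReal M :=
  exists_eLpNorm_top_le_of_energy_le hΩ
    (fun _ hN => exists_ae_abs_le hd hΩo.measurableSet hΩ hchain hC hriesz hN) hv

end Energy

theorem lemma3p1 (d : ℕ) (hd : d = 2 ∨ d = 3) :
    -- homogeneous Neumann boundary condition
    (∀ Ω : Set (EuclideanSpace ℝ (Fin d)), IsOpen Ω → IsConnected Ω → Bornology.IsBounded Ω →
      ConeCondition Ω →
      ∀ v : EuclideanSpace ℝ (Fin d) → ℝ, Admissible (compactTests Ω) Ω v →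
        ∃ M : ℝ, ∀ ε : ℝ, 0 < ε → ε < 1 →
          ∀ u : EuclideanSpace ℝ (Fin d) → ℝ, Admissible (compactTests Ω) Ω u →
            ∫ x in Ω, u x = ∫ x in Ω, v x →
            pfcEnergy (compactTests Ω) Ω ε u ≤ pfcEnergy (compactTests Ω) Ω ε v →
            eLpNorm u ∞ (volume.restrict Ω) ≤ ENNReal.ofReal M) ∧
    -- periodic boundary condition
    (∀ a b : Fin d → ℝ, (∀ i, a i < b i) →
      ∀ v : EuclideanSpace ℝ (Fin d) → ℝ, Admissible (periodicTests a b) (openBox a b) v →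
        ∃ M : ℝ, ∀ ε : ℝ, 0 < ε → ε < 1 →
          ∀ u : EuclideanSpace ℝ (Fin d) → ℝ, Admissible (periodicTests a b) (openBox a b) u →
            ∫ x in openBox a b, u x = ∫ x in openBox a b, v x →
            pfcEnergy (periodicTests a b) (openBox a b) ε u ≤
              pfcEnergy (periodicTests a b) (openBox a b) ε v →
            eLpNorm u ∞ (volume.restrict (openBox a b)) ≤ ENNReal.ofReal M) := by
  have hd0 : 0 < d := by omega
  refine ⟨fun Ω hΩo _ hΩ hcone v hv => ?_, fun a b hab v hv => ?_⟩
  · obtain ⟨C, hC, hriesz⟩ := exists_enorm_le_riesz_potential hd0 hΩo hΩ hcone.hasUniformCones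
    obtain ⟨M, hM⟩ := exists_eLpNorm_top_le hd hΩo hΩ (admitsChainRule_compactTests hΩo hΩ) hC
      hriesz hv
    exact ⟨M, fun ε h0 h1 u hu _ hE => hM ε h0 h1 u hu hE⟩
  · obtain ⟨C, hC, hriesz⟩ := exists_enorm_le_riesz_potential hd0 isOpen_openBox isBounded_openBox
      (hasUniformCones_openBox hab)
    obtain ⟨M, hM⟩ := exists_eLpNorm_top_le hd isOpen_openBox isBounded_openBox
      (admitsChainRule_periodicTests hab) hC (rieszBound_periodicTests hab hriesz) hv
    exact ⟨M, fun ε h0 h1 u hu _ hE => hM ε h0 h1 u hu hE⟩
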